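/- For a real random variable $X$ with finite variance let $D(X)\in[0,\infty]$ be the Kullback--Leibler divergence $\mathrm{KL}(X\,\|\,G_X)$ of the law of $X$ from the Gaussian law with the same mean and variance. For a random variable $X$ with an absolutely continuous density $p$ on $\mathbb{R}$ (i.e. $p$ is absolutely continuous on every compact interval) let $J(X)=\int_{\mathbb{R}}|p'|^2/p\,dx\in[0,\infty]$ be its Fisher information. Let $\varepsilon\in(0,1/2)$, $s\in(0,1)$, $r>0$ and $\kappa>0$. There is a constant $C=C(\varepsilon,s,r,\kappa)>0$, depending only on $\varepsilon,s,r,\kappa$, such that the following holds for every integer $n\ge 1$ and all real numbers $k\ge 4$ and $M$. Let $X_1,\dots,X_n$ be independent real random variables with absolutely continuous densities such that $\mathbb{E}|X_i|^k\le M$ and $J(X_i)\le\kappa n^s$ for $i=1,\dots,n$, and put $$S_n=\frac{X_1+\cdots+X_n}{\sqrt{B_n}},\qquad B_n=\sum_{i=1}^n\mathrm{Var}(X_i).$$ If $n>M^{\frac{2}{kr}}$, then $$D(S_n)\le C(\varepsilon,s,r,\kappa)\left(\frac{M^{4/k}}{n^{1-2s}}+3\right)^{1/2}\left(\frac{M^{3/k}}{n^{1/2-3s/2}}\right)^{1/2-\varepsilon}.$$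 -/

import Mathlib

open MeasureTheory ProbabilityTheory

/-- A function on the real line is (locally) absolutely continuous if it is absolutely continuous
on every compact interval. -/
def LocallyAbsolutelyContinuous (p : ℝ → ℝ) : Prop :=
  ∀ a b : ℝ, AbsolutelyContinuousOnInterval p a b

/-- `p` is an absolutely continuous probability density of the random variable `X` under `P`. -/
structure HasAbsolutelyContinuousDensity {Ω : Type*} [MeasurableSpace Ω] (P : Measure Ω)
    (X : Ω → ℝ) (p : ℝ → ℝ) : Prop where
  nonneg : ∀ x, 0 ≤ p x
  absolutelyContinuous : LocallyAbsolutelyContinuous p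
  law_eq : P.map X = volume.withDensity (fun x => ENNReal.ofReal (p x))

/-- The Fisher information `J(p) = ∫ |p'|² / p` of a nonnegative absolutely continuous function,
with values in `[0, ∞]`. At a point where `p` vanishes the integrand is `0`; there `p` has a
minimum, so that `p'` vanishes as well wherever it exists. -/
noncomputable def fisherInformation (p : ℝ → ℝ) : ENNReal :=
  ∫⁻ x, ENNReal.ofReal (|deriv p x| ^ 2 / p x)

/-- `D(X)`: the Kullback-Leibler divergence, with values in `[0, ∞]`, of the law of `X` from the
Gaussian law with the same mean and the same variance. -/
noncomputable def divergenceFromGaussian {Ω : Type*} [MeasurableSpace Ω] (P : Measure Ω)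
    (X : Ω → ℝ) : ENNReal :=
  InformationTheory.klDiv (P.map X) (gaussianReal (∫ ω, X ω ∂P) (variance X P).toNNReal)

/-- The sum `(X₁ + ⋯ + Xₙ) / √Bₙ`, where `Bₙ` is the sum of the variances. -/
noncomputable def normalizedSum {Ω : Type*} [MeasurableSpace Ω] (P : Measure Ω) {n : ℕ}
    (X : Fin n → Ω → ℝ) (ω : Ω) : ℝ :=
  (∑ i, X i ω) / Real.sqrt (∑ i, variance (X i) P)

/-! ### Fisher information: boundedness of the density and integration by parts. -/

section Fisher

variable {p : ℝ → ℝ} {J : ℝ}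

/-! Write `J = κ n ^ s`, `A = M ^ (1 / k)` and let `B` be the sum of the variances. Two numbers
govern the estimate: the normalized Fisher information `b = J B / n`, which is at least 1 by
Cramér-Rao, and the Lyapunov ratio `Λ = 8 n A ^ 3 / B ^ (3 / 2)`.

Finite Fisher information makes each characteristic function decay: integration by parts against a
rotated sine and Cauchy-Schwarz give `‖φ t‖ ^ 2 * (J + t ^ 2) ≤ J` (`norm_charFun_sq_mul_le`). For
four or more summands the product is therefore at most `(1 + t ^ 2 / (4 b)) ^ (-2)`, so Fourier
inversion applies and the density of the normalized sum is at most `2 π √b`. For `Λ ≤ 1 / 64`, a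
Lyapunov-type comparison with the Gaussian holds for `|t| ≤ 1 / (16 Λ)`
(`norm_prod_charFun_sub_exp_le`). With the decay beyond that range, the density is uniformly within
a constant times `Λ b` of the Gaussian one (`exists_integral_norm_sub_exp_le`).

A uniform distance `η` between the densities costs at most a constant times `√η` in divergence, up
to the logarithm of the bound on the density (`klDiv_gaussianReal_le_sqrt`); the tail is controlled
because the two second moments agree. When `η` is not small, boundedness of the density alone
suffices. Altogether `D ≤ C (1 + log b) √(min 1 (Λ b))` (`exists_divergence_le`).

Finally `Λ b = x / √b`, where `x` is `8 κ ^ (3 / 2)` times the base of the last power in the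
theorem. Lowering the exponent from `1 / 2` to `1 / 2 - ε` leaves a negative power of `b` that
absorbs `log b`. The other factor of the stated bound is at least 1. -/

lemma LocallyAbsolutelyContinuous.continuous (hac : LocallyAbsolutelyContinuous p) :
    Continuous p := by
  rw [continuous_iff_continuousAt]
  intro x
  have h := (hac (x - 1) (x + 1)).continuousOn
  refine h.continuousAt ?_
  rw [Set.uIcc_of_le (by linarith)]
  exact Icc_mem_nhds (by linarith) (by linarith)

lemma deriv_eq_zero_of_nonneg_of_eq_zero (hp : ∀ x, 0 ≤ p x) {x : ℝ} (hx : p x = 0) :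
    deriv p x = 0 := by
  refine IsLocalMin.deriv_eq_zero ?_
  exact Filter.Eventually.of_forall fun y => by simpa [hx] using hp y

lemma integrable_deriv_sq_div (hp : ∀ x, 0 ≤ p x) (hac : LocallyAbsolutelyContinuous p)
    (hJ : fisherInformation p ≤ ENNReal.ofReal J) :
    Integrable (fun x => |deriv p x| ^ 2 / p x) := by
  have hm : Measurable (fun x => |deriv p x| ^ 2 / p x) := by
    have := hac.continuous.measurable
    have := measurable_deriv p
    fun_prop
  refine ⟨hm.aestronglyMeasurable, ?_⟩
  rw [hasFiniteIntegral_iff_ofReal (Filter.Eventually.of_forall fun x => by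
    have := hp x; positivity)]
  exact lt_of_le_of_lt hJ ENNReal.ofReal_lt_top

lemma integral_deriv_sq_div_le (hp : ∀ x, 0 ≤ p x) (hac : LocallyAbsolutelyContinuous p)
    (hJ0 : 0 ≤ J) (hJ : fisherInformation p ≤ ENNReal.ofReal J) :
    ∫ x, |deriv p x| ^ 2 / p x ≤ J := by
  rw [integral_eq_lintegral_of_nonneg_ae (Filter.Eventually.of_forall fun x => by
    have := hp x; positivity) (integrable_deriv_sq_div hp hac hJ).aestronglyMeasurable]
  exact ENNReal.toReal_le_of_le_ofReal hJ0 hJ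

/-- Completing the square in `(g p - p') ^ 2 / p ≥ 0`. At a zero of `p` the derivative vanishes too,
so both sides are 0. This is the pointwise substitute for Cauchy-Schwarz with weights `√p` and `p' /
√p`. -/
lemma two_mul_mul_deriv_le (hp : ∀ x, 0 ≤ p x) (g : ℝ) (x : ℝ) :
    2 * (g * deriv p x) ≤ g ^ 2 * p x + |deriv p x| ^ 2 / p x := by
  rcases (hp x).eq_or_lt with h | h
  · simp [deriv_eq_zero_of_nonneg_of_eq_zero hp h.symm, ← h]
  · rw [sq_abs]
    have : g ^ 2 * p x + deriv p x ^ 2 / p x - 2 * (g * deriv p x)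
        = (g * p x - deriv p x) ^ 2 / p x := by
      field_simp
      ring
    have : 0 ≤ (g * p x - deriv p x) ^ 2 / p x := by positivity
    linarith

/-- The weight `c` is free: `c = 1` gives integrability of `p'`, and `c = √J` gives the optimal
bound on its `L¹` norm. -/
lemma abs_deriv_le (hp : ∀ x, 0 ≤ p x) {c : ℝ} (hc : 0 < c) (x : ℝ) :
    |deriv p x| ≤ (c * p x + |deriv p x| ^ 2 / p x / c) / 2 := by
  have h1 := two_mul_mul_deriv_le hp c x
  have h2 := two_mul_mul_deriv_le hp (-c) x
  have h3 : |2 * (c * deriv p x)| ≤ c ^ 2 * p x + |deriv p x| ^ 2 / p x := by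
    rw [abs_le]; constructor <;> nlinarith
  rw [abs_mul, abs_mul, abs_of_pos hc, abs_of_pos (by norm_num : (0 : ℝ) < 2)] at h3
  have : c * |deriv p x| ≤ c * ((c * p x + |deriv p x| ^ 2 / p x / c) / 2) := by
    have : c * ((c * p x + |deriv p x| ^ 2 / p x / c) / 2)
      = (c ^ 2 * p x + |deriv p x| ^ 2 / p x) / 2 := by field_simp
    linarith
  exact le_of_mul_le_mul_left this hc

lemma integrable_deriv_of_fisherInformation_le (hp : ∀ x, 0 ≤ p x)
    (hac : LocallyAbsolutelyContinuous p) (hi : Integrable p)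
    (hJ : fisherInformation p ≤ ENNReal.ofReal J) : Integrable (deriv p) := by
  refine Integrable.mono' (((hi.const_mul 1).add
    ((integrable_deriv_sq_div hp hac hJ).div_const 1)).div_const 2)
    (measurable_deriv p).aestronglyMeasurable (Filter.Eventually.of_forall fun x => ?_)
  exact abs_deriv_le hp one_pos x

lemma integral_abs_deriv_le (hp : ∀ x, 0 ≤ p x)
    (hac : LocallyAbsolutelyContinuous p) (hi : Integrable p) (h1 : ∫ x, p x = 1)
    (hJ0 : 0 < J) (hJ : fisherInformation p ≤ ENNReal.ofReal J) :
    ∫ x, |deriv p x| ≤ √J := by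
  have hs : 0 < √J := Real.sqrt_pos.2 hJ0
  have hF := integrable_deriv_sq_div hp hac hJ
  calc ∫ x, |deriv p x| ≤ ∫ x, (√J * p x + |deriv p x| ^ 2 / p x / √J) / 2 :=
        integral_mono (integrable_deriv_of_fisherInformation_le hp hac hi hJ).abs
          (((hi.const_mul _).add (hF.div_const _)).div_const 2) (abs_deriv_le hp hs)
    _ = (√J * 1 + (∫ x, |deriv p x| ^ 2 / p x) / √J) / 2 := by
        rw [integral_div, integral_add (hi.const_mul _) (hF.div_const _), integral_const_mul,
          integral_div, h1]
    _ ≤ (√J * 1 + J / √J) / 2 := by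
        gcongr
        exact integral_deriv_sq_div_le hp hac hJ0.le hJ
    _ = √J := by rw [Real.div_sqrt]; ring

/-- A density with Fisher information at most `J` is bounded by `√J`. -/
lemma le_sqrt_of_fisherInformation_le (hp : ∀ x, 0 ≤ p x)
    (hac : LocallyAbsolutelyContinuous p) (hi : Integrable p) (h1 : ∫ x, p x = 1)
    (hJ0 : 0 < J) (hJ : fisherInformation p ≤ ENNReal.ofReal J) (x : ℝ) : p x ≤ √J := by
  refine le_trans ?_ (integral_abs_deriv_le hp hac hi h1 hJ0 hJ)
  -- If `p x` exceeded the total variation `V`, then `p` would stay above the positive constant `p x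
  -- - V` on the whole line, contradicting integrability.
  by_contra! hlt
  set V := ∫ x, |deriv p x|
  have hd := integrable_deriv_of_fisherInformation_le hp hac hi hJ
  have hle : ∀ y, p x - V ≤ p y := by
    intro y
    have := (hac y x).integral_deriv_eq_sub
    have h2 : |∫ t in y..x, deriv p t| ≤ V := by
      refine (intervalIntegral.norm_integral_le_integral_norm_uIoc (f := deriv p)).trans ?_
      exact setIntegral_le_integral hd.norm (Filter.Eventually.of_forall fun x => norm_nonneg _)
    have := (abs_le.1 h2).2
    linarith
  have : Integrable (fun _ : ℝ => p x - V) :=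
    hi.mono' aestronglyMeasurable_const (Filter.Eventually.of_forall fun y => by
      rw [Real.norm_eq_abs, abs_of_pos (by linarith)]; exact hle y)
  rw [integrable_const_iff] at this
  rcases this with h | h
  · linarith
  · have := h.measure_univ_lt_top
    simp at this

/-- Integration by parts against a bounded smooth function, without boundary terms. -/
lemma integral_mul_deriv_eq_neg (hac : LocallyAbsolutelyContinuous p) (hi : Integrable p)
    (hd : Integrable (deriv p)) {g g' : ℝ → ℝ} {K K' : ℝ}
    (hg : ∀ x, HasDerivAt g (g' x) x) (hg' : Continuous g')
    (hK : ∀ x, |g x| ≤ K) (hK' : ∀ x, |g' x| ≤ K') :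
    ∫ x, g x * deriv p x = -∫ x, g' x * p x := by
  have hgc : Continuous g := continuous_iff_continuousAt.2 fun x => (hg x).continuousAt
  have hder : deriv g = g' := funext fun x => (hg x).deriv
  have i1 : Integrable (fun x => g x * deriv p x) :=
    hd.bdd_mul hgc.aestronglyMeasurable (Filter.Eventually.of_forall hK)
  have i2 : Integrable (fun x => g' x * p x) :=
    hi.bdd_mul hg'.aestronglyMeasurable (Filter.Eventually.of_forall hK')
  have i3 : Integrable (fun x => g x * p x) :=
    hi.bdd_mul hgc.aestronglyMeasurable (Filter.Eventually.of_forall hK)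
  have hC1 : ContDiff ℝ 1 g :=
    contDiff_one_iff_deriv.2 ⟨fun x => (hg x).differentiableAt, by rwa [hder]⟩
  have hfin : ∀ R : ℝ, ∫ x in (-R)..R, (g' x * p x + g x * deriv p x)
      = g R * p R - g (-R) * p (-R) := by
    intro R
    have := (hC1.contDiffOn (s := Set.uIcc (-R) R)).absolutelyContinuousOnInterval
    rw [← this.integral_deriv_mul_eq_sub (hac (-R) R), hder]
  have hlim := intervalIntegral_tendsto_integral (i2.add i1)
    Filter.tendsto_neg_atTop_atBot Filter.tendsto_id
  -- The boundary term converges as `R → ∞` and is integrable in `R`, so its limit is 0; no decay of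
  -- `p` at infinity has to be proved.
  have hint : Integrable (fun R => g R * p R - g (-R) * p (-R)) := i3.sub i3.comp_neg
  have hz : ∫ x, (g' x * p x + g x * deriv p x) = 0 := by
    have h : Filter.Tendsto (fun R => g R * p R - g (-R) * p (-R)) Filter.atTop
        (nhds (∫ x, (g' x * p x + g x * deriv p x))) := by
      simp only [← hfin]
      exact hlim
    refine IntegrableAtFilter.eq_zero_of_tendsto (μ := volume) (hint.integrableAtFilter _) ?_ h
    intro s hs
    rcases Filter.mem_atTop_sets.1 hs with ⟨a, ha⟩
    exact top_le_iff.1 (le_trans (by simp) (measure_mono (s := Set.Ici a) ha))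
  rw [integral_add i2 i1] at hz
  linarith

/-- Cauchy-Schwarz for `g √p` and `p' / √p`, obtained from the discriminant of a nonnegative
quadratic in `c`. -/
lemma sq_integral_mul_deriv_le (hp : ∀ x, 0 ≤ p x)
    (hac : LocallyAbsolutelyContinuous p) (hi : Integrable p)
    (hJ0 : 0 ≤ J) (hJ : fisherInformation p ≤ ENNReal.ofReal J) {g : ℝ → ℝ} {K : ℝ}
    (hg : Continuous g) (hK : ∀ x, |g x| ≤ K) :
    (∫ x, g x * deriv p x) ^ 2 ≤ (∫ x, g x ^ 2 * p x) * J := by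
  have hd := integrable_deriv_of_fisherInformation_le hp hac hi hJ
  have hF := integrable_deriv_sq_div hp hac hJ
  have i1 : Integrable (fun x => g x * deriv p x) :=
    hd.bdd_mul hg.aestronglyMeasurable (Filter.Eventually.of_forall hK)
  have i2 : Integrable (fun x => g x ^ 2 * p x) := by
    refine hi.bdd_mul (c := K ^ 2) (hg.pow 2).aestronglyMeasurable
      (Filter.Eventually.of_forall fun x => ?_)
    rw [norm_pow, Real.norm_eq_abs]
    exact pow_le_pow_left₀ (abs_nonneg _) (hK x) 2
  have key : ∀ c : ℝ, 0 ≤ (∫ x, g x ^ 2 * p x) * (c * c) + (-(2 * ∫ x, g x * deriv p x)) * c + J := by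
    intro c
    have h : ∫ x, 2 * c * (g x * deriv p x) ≤ ∫ x, (c ^ 2 * (g x ^ 2 * p x) + |deriv p x| ^ 2 / p x) := by
      refine integral_mono (i1.const_mul _) ((i2.const_mul _).add hF) fun x => ?_
      have := two_mul_mul_deriv_le hp (c * g x) x
      simp only
      nlinarith
    rw [integral_const_mul, integral_add (i2.const_mul _) hF, integral_const_mul] at h
    have := integral_deriv_sq_div_le hp hac hJ0 hJ
    nlinarith
  have := discrim_le_zero key
  rw [discrim] at this
  nlinarith

end Fisher

/-! ### Decay of characteristic functions and the Cramér-Rao bound. -/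

section FisherCharFun

variable {p : ℝ → ℝ} {J : ℝ} {μ : Measure ℝ}

lemma integral_withDensity_ofReal {E : Type*} [NormedAddCommGroup E] [NormedSpace ℝ E]
    (hp : ∀ x, 0 ≤ p x) (hm : Measurable p) (h : ℝ → E) :
    ∫ x, h x ∂(volume.withDensity fun x => ENNReal.ofReal (p x)) = ∫ x, p x • h x := by
  rw [integral_withDensity_eq_integral_toReal_smul (by fun_prop) (by simp)]
  simp only [ENNReal.toReal_ofReal (hp _)]

lemma integrable_withDensity_ofReal_iff (hp : ∀ x, 0 ≤ p x) (hm : Measurable p) {h : ℝ → ℝ} :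
    Integrable h (volume.withDensity fun x => ENNReal.ofReal (p x)) ↔
      Integrable (fun x => h x * p x) := by
  rw [integrable_withDensity_iff (by fun_prop) (by simp)]
  simp only [ENNReal.toReal_ofReal (hp _)]

lemma integrable_of_withDensity_isFiniteMeasure (hp : ∀ x, 0 ≤ p x) (hm : Measurable p)
    [IsFiniteMeasure (volume.withDensity fun x => ENNReal.ofReal (p x))] : Integrable p := by
  have := (integrable_withDensity_ofReal_iff hp hm (h := fun _ => (1 : ℝ))).1 (integrable_const 1)
  simpa using this

lemma integral_eq_one_of_withDensity (hp : ∀ x, 0 ≤ p x) (hm : Measurable p)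
    [IsProbabilityMeasure (volume.withDensity fun x => ENNReal.ofReal (p x))] :
    ∫ x, p x = 1 := by
  have := integral_withDensity_ofReal hp hm (fun _ => (1 : ℝ))
  simpa using this.symm

/-- Rotating by the argument of the characteristic function turns its modulus into a real cosine
integral, to which real integration by parts applies. -/
lemma charFun_rotate [IsFiniteMeasure μ] (t : ℝ) : ∃ θ : ℝ,
    ∫ x, Real.cos (t * x - θ) ∂μ = ‖charFun μ t‖ := by
  refine ⟨(charFun μ t).arg, ?_⟩
  set θ := (charFun μ t).arg
  have h1 : Complex.exp (-(θ * Complex.I)) * charFun μ t = ‖charFun μ t‖ := by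
    conv_lhs => rw [← Complex.norm_mul_exp_arg_mul_I (charFun μ t)]
    rw [mul_left_comm, ← Complex.exp_add]
    simp [θ]
  have h2 : Complex.exp (-(θ * Complex.I)) * charFun μ t
      = ∫ x, Complex.exp (((t * x - θ : ℝ) : ℂ) * Complex.I) ∂μ := by
    rw [charFun_apply_real, ← integral_const_mul]
    congr 1 with x
    rw [← Complex.exp_add]
    congr 1
    push_cast
    ring
  have h3 : Integrable (fun x => Complex.exp (((t * x - θ : ℝ) : ℂ) * Complex.I)) μ := by
    refine Integrable.of_bound (C := 1) (Continuous.aestronglyMeasurable (by fun_prop))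
      (Filter.Eventually.of_forall fun x => by rw [Complex.norm_exp_ofReal_mul_I])
  have h4 := congrArg Complex.re (h2.symm.trans h1)
  rw [Complex.ofReal_re] at h4
  rw [← h4, ← RCLike.re_eq_complex_re, ← integral_re h3]
  simp only [RCLike.re_eq_complex_re, Complex.exp_ofReal_mul_I_re]

/-- Since `sin² = 1 - cos²`, this is `(E cos)² ≤ E cos²`. -/
lemma integral_sin_sq_le [IsProbabilityMeasure μ] {t θ F : ℝ}
    (h : ∫ x, Real.cos (t * x - θ) ∂μ = F) :
    ∫ x, Real.sin (t * x - θ) ^ 2 ∂μ ≤ 1 - F ^ 2 := by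
  have i1 : Integrable (fun x => Real.cos (t * x - θ)) μ :=
    Integrable.of_bound (C := 1) (Continuous.aestronglyMeasurable (by fun_prop))
      (Filter.Eventually.of_forall fun x => Real.abs_cos_le_one _)
  have i2 : Integrable (fun x => Real.sin (t * x - θ) ^ 2) μ :=
    Integrable.of_bound (C := 1) (Continuous.aestronglyMeasurable (by fun_prop))
      (Filter.Eventually.of_forall fun x => by
        rw [Real.norm_eq_abs, abs_of_nonneg (sq_nonneg _)]; exact Real.sin_sq_le_one _)
  have : ∫ x, Real.sin (t * x - θ) ^ 2 ∂μ
      ≤ ∫ x, (1 + F ^ 2 - 2 * F * Real.cos (t * x - θ)) ∂μ := by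
    refine integral_mono i2 ((integrable_const _).sub (i1.const_mul _)) fun x => ?_
    have := Real.sin_sq_add_cos_sq (t * x - θ)
    simp only
    nlinarith [sq_nonneg (Real.cos (t * x - θ) - F)]
  rw [integral_sub (integrable_const _) (i1.const_mul _), integral_const_mul, h] at this
  simp at this
  linarith

/-- Decay of the characteristic function of a law with Fisher information at most `J`. -/
lemma norm_charFun_sq_mul_le (hp : ∀ x, 0 ≤ p x) (hac : LocallyAbsolutelyContinuous p)
    (hμ : μ = volume.withDensity fun x => ENNReal.ofReal (p x)) [IsProbabilityMeasure μ]
    (hJ0 : 0 ≤ J) (hJ : fisherInformation p ≤ ENNReal.ofReal J) (t : ℝ) :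
    ‖charFun μ t‖ ^ 2 * (J + t ^ 2) ≤ J := by
  obtain ⟨θ, hθ⟩ := charFun_rotate (μ := μ) t
  have hs := integral_sin_sq_le hθ
  have hm := hac.continuous.measurable
  have hi : Integrable p := by
    subst hμ; exact integrable_of_withDensity_isFiniteMeasure hp hm
  have hd := integrable_deriv_of_fisherInformation_le hp hac hi hJ
  rw [hμ, integral_withDensity_ofReal hp hm, ← hμ] at hθ hs
  set F := ‖charFun μ t‖
  have hg : ∀ x, HasDerivAt (fun x => Real.sin (t * x - θ)) (t * Real.cos (t * x - θ)) x := by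
    intro x
    have := (((hasDerivAt_id x).const_mul t).sub_const θ).sin
    simpa [mul_comm] using this
  -- With `g = sin (t x - θ)`, integration by parts gives `t F = -∫ g p'`; Cauchy-Schwarz and the
  -- bound on `∫ sin²` then give `t² F² ≤ (1 - F²) J`, which rearranges to the claim.
  have h1 := integral_mul_deriv_eq_neg hac hi hd hg (by fun_prop)
    (K := 1) (K' := |t|) (fun x => Real.abs_sin_le_one _) (fun x => by
      rw [abs_mul]
      exact mul_le_of_le_one_right (abs_nonneg _) (Real.abs_cos_le_one _))
  have h2 := sq_integral_mul_deriv_le hp hac hi hJ0 hJ (g := fun x => Real.sin (t * x - θ))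
    (K := 1) (by fun_prop) (fun x => Real.abs_sin_le_one _)
  have h3 : ∫ x, t * Real.cos (t * x - θ) * p x = t * F := by
    rw [← hθ, ← integral_const_mul]
    congr 1 with x
    simp only [smul_eq_mul]; ring
  have h4 : ∫ x, Real.sin (t * x - θ) ^ 2 * p x = ∫ x, p x • Real.sin (t * x - θ) ^ 2 := by
    congr 1 with x
    simp only [smul_eq_mul]; ring
  rw [h1, h3, h4] at h2
  nlinarith

/-- Centring only changes the phase; then take real parts and use `cos y ≥ 1 - y² / 2`. -/
lemma one_sub_le_norm_charFun [IsProbabilityMeasure μ] (h2 : MemLp id 2 μ) (t : ℝ) :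
    1 - t ^ 2 * Var[id; μ] / 2 ≤ ‖charFun μ t‖ := by
  set m := ∫ x, x ∂μ
  have hv : Var[id; μ] = ∫ x, (x - m) ^ 2 ∂μ := by
    rw [variance_eq_integral aemeasurable_id]; rfl
  have h3 : ‖charFun μ t‖ = ‖∫ x, Complex.exp (((t * (x - m) : ℝ) : ℂ) * Complex.I) ∂μ‖ := by
    have : ∫ x, Complex.exp (((t * (x - m) : ℝ) : ℂ) * Complex.I) ∂μ
        = Complex.exp (((-(t * m) : ℝ) : ℂ) * Complex.I) * charFun μ t := by
      rw [charFun_apply_real, ← integral_const_mul]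
      congr 1 with x
      rw [← Complex.exp_add]
      congr 1
      push_cast
      ring
    rw [this, norm_mul, Complex.norm_exp_ofReal_mul_I, one_mul]
  have i3 : Integrable (fun x => Complex.exp (((t * (x - m) : ℝ) : ℂ) * Complex.I)) μ := by
    refine Integrable.of_bound (C := 1) (Continuous.aestronglyMeasurable (by fun_prop))
      (Filter.Eventually.of_forall fun x => by rw [Complex.norm_exp_ofReal_mul_I])
  have i2 : Integrable (fun x => (x - m) ^ 2) μ :=
    (h2.sub (memLp_const m)).integrable_sq
  rw [h3, hv]
  refine le_trans ?_ (Complex.re_le_norm _)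
  rw [← RCLike.re_eq_complex_re, ← integral_re i3]
  simp only [RCLike.re_eq_complex_re, Complex.exp_ofReal_mul_I_re]
  have i1 : Integrable (fun x => Real.cos (t * (x - m))) μ :=
    Integrable.of_bound (C := 1) (Continuous.aestronglyMeasurable (by fun_prop))
      (Filter.Eventually.of_forall fun x => Real.abs_cos_le_one _)
  have : ∫ x, (1 - t ^ 2 / 2 * (x - m) ^ 2) ∂μ ≤ ∫ x, Real.cos (t * (x - m)) ∂μ := by
    refine integral_mono ((integrable_const _).sub (i2.const_mul _)) i1 fun x => ?_
    have := Real.one_sub_sq_div_two_le_cos (x := t * (x - m))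
    simp only
    nlinarith
  rw [integral_sub (integrable_const _) (i2.const_mul _), integral_const_mul] at this
  simp at this
  linarith

/-- The Cramér-Rao bound for the variance. -/
lemma one_le_mul_variance_of_charFun [IsProbabilityMeasure μ] (h2 : MemLp id 2 μ) (hJ0 : 0 ≤ J)
    (h : ∀ t, ‖charFun μ t‖ ^ 2 * (J + t ^ 2) ≤ J) : 1 ≤ J * Var[id; μ] := by
  set V := Var[id; μ]
  have hV : 0 ≤ V := variance_nonneg _ _
  -- The decay bound and the second-order lower bound at the origin must be compatible; dividing by
  -- `t²` and letting `t → 0` leaves Cramér-Rao.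
  have key : ∀ t : ℝ, 0 < t → 1 ≤ (J + t ^ 2) * V := by
    intro t ht
    have h1 := one_sub_le_norm_charFun h2 t
    have h3 : 1 - t ^ 2 * V ≤ ‖charFun μ t‖ ^ 2 := by nlinarith [sq_nonneg (‖charFun μ t‖ - 1)]
    have h4 : (1 - t ^ 2 * V) * (J + t ^ 2) ≤ J :=
      (mul_le_mul_of_nonneg_right h3 (by positivity)).trans (h t)
    have h5 : 0 < t ^ 2 := by positivity
    by_contra! hlt
    nlinarith
  refine ge_of_tendsto (f := fun t : ℝ => (J + t ^ 2) * V) (x := nhdsWithin 0 (Set.Ioi 0)) ?_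
    (eventually_nhdsWithin_of_forall fun t ht => key t ht)
  have : Continuous fun t : ℝ => (J + t ^ 2) * V := by fun_prop
  have h := this.tendsto 0
  simp only [ne_eq, OfNat.ofNat_ne_zero, not_false_eq_true, zero_pow, add_zero] at h
  exact h.mono_left nhdsWithin_le_nhds

end FisherCharFun

/-! ### A bounded continuous density for the normalized sum. -/

section SumDensity

/-- The density is `x ↦ ∫ p (x - y) dν(y)`, which inherits continuity and the bound `K`. A single
summand with a bounded density is therefore enough for the whole sum. -/
lemma conv_withDensity_eq {p : ℝ → ℝ} {K : ℝ} (hp : ∀ x, 0 ≤ p x) (hc : Continuous p)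
    (hK : ∀ x, p x ≤ K) (ν : Measure ℝ) [IsProbabilityMeasure ν] :
    ∃ q : ℝ → ℝ, (∀ x, 0 ≤ q x) ∧ Continuous q ∧ (∀ x, q x ≤ K) ∧
      (volume.withDensity fun x => ENNReal.ofReal (p x)).conv ν
        = volume.withDensity fun x => ENNReal.ofReal (q x) := by
  have hi : ∀ x, Integrable (fun y => p (x - y)) ν := fun x =>
    Integrable.of_bound (C := K) (Continuous.aestronglyMeasurable (by fun_prop))
      (Filter.Eventually.of_forall fun y => by
        rw [Real.norm_eq_abs, abs_of_nonneg (hp _)]; exact hK _)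
  refine ⟨fun x => ∫ y, p (x - y) ∂ν, fun x => integral_nonneg fun y => hp _, ?_, fun x => ?_, ?_⟩
  · refine continuous_of_dominated (bound := fun _ => K)
      (fun x => Continuous.aestronglyMeasurable (by fun_prop)) (fun x => ?_) (integrable_const K)
      (Filter.Eventually.of_forall fun y => by fun_prop)
    exact Filter.Eventually.of_forall fun y => by
      rw [Real.norm_eq_abs, abs_of_nonneg (hp _)]; exact hK _
  · calc ∫ y, p (x - y) ∂ν ≤ ∫ _, K ∂ν := integral_mono (hi x) (integrable_const K) fun y => hK _
      _ = K := by simp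
  · ext A hA
    have hm := hc.measurable
    rw [withDensity_apply _ hA, ← lintegral_indicator_one hA,
      Measure.lintegral_conv (measurable_one.indicator hA),
      lintegral_withDensity_eq_lintegral_mul _ (by fun_prop)
        (Measurable.lintegral_prod_right' (f := fun z : ℝ × ℝ => A.indicator 1 (z.1 + z.2))
          ((measurable_one.indicator hA).comp measurable_add))]
    have hmI : Measurable (A.indicator (1 : ℝ → ENNReal)) := measurable_one.indicator hA
    calc ∫⁻ x, ((fun x => ENNReal.ofReal (p x)) * fun x => ∫⁻ y, A.indicator 1 (x + y) ∂ν) x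
        = ∫⁻ x, ∫⁻ y, ENNReal.ofReal (p x) * A.indicator 1 (x + y) ∂ν := by
          refine lintegral_congr fun x => ?_
          rw [Pi.mul_apply, lintegral_const_mul _ (by fun_prop)]
      _ = ∫⁻ y, (∫⁻ x, ENNReal.ofReal (p x) * A.indicator 1 (x + y)) ∂ν :=
          lintegral_lintegral_swap (Measurable.aemeasurable (by fun_prop))
      _ = ∫⁻ y, (∫⁻ x, ENNReal.ofReal (p (x - y)) * A.indicator 1 x) ∂ν := by
          refine lintegral_congr fun y => ?_
          rw [← lintegral_sub_right_eq_self
            (fun x => ENNReal.ofReal (p x) * A.indicator 1 (x + y)) y]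
          simp
      _ = ∫⁻ x, (∫⁻ y, ENNReal.ofReal (p (x - y)) * A.indicator 1 x ∂ν) :=
          lintegral_lintegral_swap (Measurable.aemeasurable (by fun_prop))
      _ = ∫⁻ x, A.indicator (fun x => ENNReal.ofReal (∫ y, p (x - y) ∂ν)) x := by
          refine lintegral_congr fun x => ?_
          rw [lintegral_mul_const _ (by fun_prop),
            ← ofReal_integral_eq_lintegral_ofReal (hi x) (Filter.Eventually.of_forall fun y => hp _)]
          by_cases hx : x ∈ A <;> simp [hx]
      _ = ∫⁻ x in A, ENNReal.ofReal (∫ y, p (x - y) ∂ν) := lintegral_indicator hA _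

lemma map_div_withDensity (q : ℝ → ℝ) (hm : Measurable q) {c : ℝ} (hc : 0 < c) :
    (volume.withDensity fun x => ENNReal.ofReal (q x)).map (fun x => x / c)
      = volume.withDensity fun x => ENNReal.ofReal (c * q (c * x)) := by
  ext A hA
  have hmd : Measurable fun x : ℝ => x / c := by fun_prop
  rw [Measure.map_apply hmd hA, withDensity_apply _ (hmd hA), withDensity_apply _ hA,
    ← lintegral_indicator (hmd hA), ← lintegral_indicator hA]
  have h := Real.smul_map_volume_mul_left hc.ne'
  have hmf : Measurable (((fun x : ℝ => x / c) ⁻¹' A).indicator fun x => ENNReal.ofReal (q x)) :=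
    Measurable.indicator (by fun_prop) (hmd hA)
  conv_lhs => rw [← h]
  rw [lintegral_smul_measure, lintegral_map hmf (by fun_prop), smul_eq_mul]
  refine (lintegral_const_mul (ENNReal.ofReal |c|)
    (hmf.comp (by fun_prop : Measurable fun x : ℝ => c * x))).symm.trans ?_
  refine lintegral_congr fun x => ?_
  have : (c * x) / c = x := by field_simp
  by_cases hx : x ∈ A
  · simp [this, hx, ENNReal.ofReal_mul, hc.le, abs_of_pos hc]
  · simp [this, hx]

variable {Ω : Type*} [MeasurableSpace Ω] {P : Measure Ω} {n : ℕ}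
  {X : Fin n → Ω → ℝ} {p : Fin n → ℝ → ℝ} {J : ℝ}

lemma measurable_normalizedSum (hX : ∀ i, Measurable (X i)) :
    Measurable (normalizedSum P X) := by
  unfold normalizedSum
  fun_prop

/-- The normalized sum has a bounded continuous density. -/
lemma exists_density_normalizedSum [IsProbabilityMeasure P]
    (hX : ∀ i, Measurable (X i)) (hind : iIndepFun X P)
    (hp : ∀ i, HasAbsolutelyContinuousDensity P (X i) (p i)) (hJ0 : 0 < J)
    (hJ : ∀ i, fisherInformation (p i) ≤ ENNReal.ofReal J)
    (hB : 0 < ∑ i, variance (X i) P) (i₀ : Fin n) :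
    ∃ q : ℝ → ℝ, (∀ x, 0 ≤ q x) ∧ Continuous q ∧
      (∀ x, q x ≤ √(∑ i, variance (X i) P) * √J) ∧
      P.map (normalizedSum P X) = volume.withDensity fun x => ENNReal.ofReal (q x) := by
  set c := √(∑ i, variance (X i) P) with hcdef
  have hc : 0 < c := Real.sqrt_pos.2 hB
  have hpi := hp i₀
  have hprob : IsProbabilityMeasure (volume.withDensity fun x => ENNReal.ofReal (p i₀ x)) := by
    rw [← hpi.law_eq]; exact Measure.isProbabilityMeasure_map (hX i₀).aemeasurable
  have hcont := hpi.absolutelyContinuous.continuous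
  have hK := le_sqrt_of_fisherInformation_le hpi.nonneg hpi.absolutelyContinuous
    (integrable_of_withDensity_isFiniteMeasure hpi.nonneg hcont.measurable)
    (integral_eq_one_of_withDensity hpi.nonneg hcont.measurable) hJ0 (hJ i₀)
  have hsum : ∀ t : Finset (Fin n), Measurable (∑ j ∈ t, X j) := fun t => by
    have h := Finset.measurable_sum t fun i _ => hX i
    convert h using 1
    ext ω
    simp
  have hR := hsum (Finset.univ.erase i₀)
  have := Measure.isProbabilityMeasure_map (μ := P) hR.aemeasurable
  obtain ⟨q, hq0, hqc, hqK, hq⟩ := conv_withDensity_eq hpi.nonneg hcont hK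
    (P.map (∑ j ∈ Finset.univ.erase i₀, X j))
  refine ⟨fun x => c * q (c * x), fun x => mul_nonneg hc.le (hq0 _), by fun_prop,
    fun x => mul_le_mul_of_nonneg_left (hqK _) hc.le, ?_⟩
  rw [← map_div_withDensity q hqc.measurable hc, ← hq, ← hpi.law_eq,
    ← (hind.indepFun_finsetSum_of_notMem hX (Finset.notMem_erase i₀ _)).symm.map_add_eq_map_conv_map
      (hX i₀) hR, Finset.add_sum_erase _ _ (Finset.mem_univ i₀), Measure.map_map (by fun_prop)
      (hsum _)]
  congr 1
  ext ω
  simp [normalizedSum, hcdef]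

end SumDensity

/-! ### From bounds on densities to bounds on the divergence. -/

section Divergence

open InformationTheory

lemma neg_log_gaussianPDFReal_le (m x : ℝ) :
    -Real.log (gaussianPDFReal m 1 x) ≤ 1 + (x - m) ^ 2 / 2 := by
  have h2 : Real.log (√(2 * Real.pi)) ≤ 1 := by
    rw [Real.log_sqrt (by positivity)]
    have : Real.log (2 * Real.pi) ≤ 2 := by
      rw [Real.log_le_iff_le_exp (by positivity)]
      have h := Real.exp_one_gt_d9
      have : Real.exp 2 = Real.exp 1 * Real.exp 1 := by rw [← Real.exp_add]; norm_num
      have := Real.pi_lt_d2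
      nlinarith
    linarith
  rw [gaussianPDFReal]
  simp only [NNReal.coe_one, mul_one]
  rw [Real.log_mul (by positivity) (by positivity), Real.log_inv, Real.log_exp]
  linarith

/-- With `r = q / φ`: for `r ≥ 1`, `log r ≤ r - 1` gives `r log r + 1 - r ≤ (r - 1) log r`; for `r ≤
1`, the term `r log r` is nonpositive and `φ - q` remains. -/
lemma mul_klFun_div_le_abs {q φ K Λ : ℝ} (hφ : 0 < φ) (hq : 0 ≤ q) (hqK : q ≤ K) (hK : 1 ≤ K)
    (hΛ : 0 ≤ Λ) (hlog : -Real.log φ ≤ Λ) :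
    φ * klFun (q / φ) ≤ |q - φ| * (1 + Real.log K + Λ) := by
  have hLK : 0 ≤ Real.log K := Real.log_nonneg hK
  rcases hq.eq_or_lt with h | h
  · subst h
    simp [klFun_zero, abs_of_pos hφ]
    nlinarith [mul_nonneg hφ.le hLK, mul_nonneg hφ.le hΛ]
  have hr : 0 < q / φ := by positivity
  have hlr : Real.log (q / φ) ≤ 1 + Real.log K + Λ := by
    rw [Real.log_div h.ne' hφ.ne']
    have := Real.log_le_log h hqK
    linarith
  have hqr : φ * (q / φ) = q := by field_simp
  rw [klFun_apply]
  rcases le_total φ q with h1 | h1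
  · rw [abs_of_nonneg (by linarith)]
    have h2 := Real.log_le_sub_one_of_pos hr
    calc φ * (q / φ * Real.log (q / φ) + 1 - q / φ)
        ≤ φ * ((q / φ - 1) * Real.log (q / φ)) := by
          refine mul_le_mul_of_nonneg_left ?_ hφ.le
          linarith
      _ = (q - φ) * Real.log (q / φ) := by rw [← mul_assoc, mul_sub, hqr, mul_one]
      _ ≤ _ := mul_le_mul_of_nonneg_left hlr (by linarith)
  · rw [abs_of_nonpos (by linarith)]
    have h2 : Real.log (q / φ) ≤ 0 := Real.log_nonpos hr.le ((div_le_one hφ).2 h1)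
    calc φ * (q / φ * Real.log (q / φ) + 1 - q / φ)
        ≤ φ * (1 - q / φ) := by
          refine mul_le_mul_of_nonneg_left ?_ hφ.le
          nlinarith
      _ = (φ - q) := by rw [mul_sub, hqr, mul_one]
      _ ≤ _ := by nlinarith

/-- The crude companion, used when `q` need not be close to `φ`. -/
lemma mul_klFun_div_le_add {q φ K Λ : ℝ} (hφ : 0 < φ) (hq : 0 ≤ q) (hqK : q ≤ K)
    (hlog : -Real.log φ ≤ Λ) :
    φ * klFun (q / φ) ≤ q * (Real.log K + Λ) + φ := by
  rcases hq.eq_or_lt with h | h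
  · subst h
    simp [klFun_zero]
  have hqr : φ * (q / φ) = q := by field_simp
  rw [klFun_apply, Real.log_div h.ne' hφ.ne', mul_sub, mul_add, mul_one, ← mul_assoc, hqr]
  have := Real.log_le_log h hqK
  nlinarith

/-- Inside the window the uniform bound `η` is used. Outside it, `q + φ` is rewritten as `(q - φ) +
2 φ`: the function `u² (q - φ)` has integral 0 over the whole line when the second moments agree,
and the Gaussian tail is bounded by its sixth moment. No moment of `q` beyond the second is needed.
The factor 2 in the window pays for the possibly negative values of `u² (q - φ)` there. -/
lemma mul_klFun_div_le_truncated {q φ K η u T : ℝ} (hφ : 0 < φ) (hq : 0 ≤ q) (hqK : q ≤ K)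
    (hK : 1 ≤ K) (hlog : -Real.log φ ≤ 1 + u ^ 2 / 2) (hη : |q - φ| ≤ η) (hT : 1 ≤ T) :
    φ * klFun (q / φ) ≤
      (Set.Icc (-T) T).indicator (fun _ => 2 * (3 + Real.log K) * T ^ 2 * η) u
        + (3 + Real.log K) * (u ^ 2 * q - u ^ 2 * φ + 2 / T ^ 4 * (u ^ 6 * φ)) := by
  have hLK : 0 ≤ Real.log K := Real.log_nonneg hK
  have h1 := mul_klFun_div_le_abs hφ hq hqK hK (by positivity) hlog
  set a := 3 + Real.log K with ha
  have ha3 : 3 ≤ a := by linarith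
  have hη0 : 0 ≤ η := (abs_nonneg _).trans hη
  have hT2 : 1 ≤ T ^ 2 := by nlinarith
  have hrem : 0 ≤ 2 / T ^ 4 * (u ^ 6 * φ) := by positivity
  by_cases hu : u ∈ Set.Icc (-T) T
  · rw [Set.indicator_of_mem hu]
    have hu2 : u ^ 2 ≤ T ^ 2 := sq_le_sq' hu.1 hu.2
    have h2 : φ * klFun (q / φ) ≤ η * (a * T ^ 2) := by
      refine h1.trans (mul_le_mul hη ?_ (by positivity) hη0)
      nlinarith
    have h3 : -(T ^ 2 * η) ≤ u ^ 2 * q - u ^ 2 * φ := by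
      have : u ^ 2 * |q - φ| ≤ T ^ 2 * η := mul_le_mul hu2 hη (abs_nonneg _) (by positivity)
      have := neg_abs_le (q - φ)
      nlinarith [sq_nonneg u]
    have h4 : a * (-(T ^ 2 * η)) ≤ a * (u ^ 2 * q - u ^ 2 * φ + 2 / T ^ 4 * (u ^ 6 * φ)) :=
      mul_le_mul_of_nonneg_left (by linarith) (by linarith)
    nlinarith
  · rw [Set.indicator_of_notMem hu, zero_add]
    have hu2 : T ^ 2 ≤ u ^ 2 := by
      rw [← sq_abs u]
      have : T ≤ |u| := by
        by_contra! hlt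
        exact hu (by rw [Set.mem_Icc]; exact abs_le.1 hlt.le)
      exact pow_le_pow_left₀ (by linarith) this 2
    have h2 : φ * klFun (q / φ) ≤ (q + φ) * (a * u ^ 2) := by
      refine h1.trans (mul_le_mul ?_ ?_ (by positivity) (by positivity))
      · rw [abs_le]; constructor <;> linarith
      · nlinarith
    have h3 : u ^ 2 * φ ≤ 1 / T ^ 4 * (u ^ 6 * φ) := by
      rw [div_mul_eq_mul_div, le_div_iff₀ (by positivity)]
      have : T ^ 4 ≤ u ^ 4 := by nlinarith
      have := mul_le_mul_of_nonneg_left this (by positivity : 0 ≤ u ^ 2 * φ)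
      nlinarith
    have h4 : a * ((q + φ) * u ^ 2)
        ≤ a * (u ^ 2 * q - u ^ 2 * φ + 2 / T ^ 4 * (u ^ 6 * φ)) := by
      refine mul_le_mul_of_nonneg_left ?_ (by linarith)
      have : 2 / T ^ 4 * (u ^ 6 * φ) = 2 * (1 / T ^ 4 * (u ^ 6 * φ)) := by ring
      linarith
    linarith

lemma klDiv_withDensity_gaussianReal {q : ℝ → ℝ} (hq : ∀ x, 0 ≤ q x) (hm : Measurable q)
    [IsFiniteMeasure (volume.withDensity fun x => ENNReal.ofReal (q x))] (m : ℝ) :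
    klDiv (volume.withDensity fun x => ENNReal.ofReal (q x)) (gaussianReal m 1)
      = ∫⁻ x, ENNReal.ofReal (gaussianPDFReal m 1 x * klFun (q x / gaussianPDFReal m 1 x)) := by
  have hφ : ∀ x, 0 < gaussianPDFReal m 1 x := fun x => gaussianPDFReal_pos m 1 x one_ne_zero
  have hφm : Measurable (gaussianPDFReal m 1) := measurable_gaussianPDFReal m 1
  have hμ : (volume.withDensity fun x => ENNReal.ofReal (q x))
      = (gaussianReal m 1).withDensity fun x => ENNReal.ofReal (q x / gaussianPDFReal m 1 x) := by
    rw [gaussianReal_of_var_ne_zero m one_ne_zero, ← withDensity_mul _ (by fun_prop) (by fun_prop)]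
    congr 1 with x
    rw [Pi.mul_apply, gaussianPDF, ← ENNReal.ofReal_mul (hφ x).le]
    congr 1
    field_simp [(hφ x).ne']
  have hac : (volume.withDensity fun x => ENNReal.ofReal (q x)) ≪ gaussianReal m 1 := by
    rw [hμ]; exact withDensity_absolutelyContinuous _ _
  rw [klDiv_eq_lintegral_klFun_of_ac hac]
  have hrn : (volume.withDensity fun x => ENNReal.ofReal (q x)).rnDeriv (gaussianReal m 1)
      =ᵐ[gaussianReal m 1] fun x => ENNReal.ofReal (q x / gaussianPDFReal m 1 x) := by
    rw [hμ]; exact Measure.rnDeriv_withDensity _ (by fun_prop)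
  calc ∫⁻ x, ENNReal.ofReal (klFun ((volume.withDensity
        fun x => ENNReal.ofReal (q x)).rnDeriv (gaussianReal m 1) x).toReal) ∂(gaussianReal m 1)
      = ∫⁻ x, ENNReal.ofReal (klFun (q x / gaussianPDFReal m 1 x)) ∂(gaussianReal m 1) := by
        refine lintegral_congr_ae ?_
        filter_upwards [hrn] with x hx
        rw [hx, ENNReal.toReal_ofReal (div_nonneg (hq x) (hφ x).le)]
    _ = _ := by
        rw [gaussianReal_of_var_ne_zero m one_ne_zero,
          lintegral_withDensity_eq_lintegral_mul _ (by fun_prop) (by fun_prop)]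
        refine lintegral_congr fun x => ?_
        rw [Pi.mul_apply, gaussianPDF, ← ENNReal.ofReal_mul (hφ x).le]

lemma klDiv_withDensity_gaussianReal_le {q H : ℝ → ℝ} (hq : ∀ x, 0 ≤ q x) (hm : Measurable q)
    [IsFiniteMeasure (volume.withDensity fun x => ENNReal.ofReal (q x))] (m : ℝ)
    (hH : Integrable H)
    (h : ∀ x, gaussianPDFReal m 1 x * klFun (q x / gaussianPDFReal m 1 x) ≤ H x) :
    klDiv (volume.withDensity fun x => ENNReal.ofReal (q x)) (gaussianReal m 1)
      ≤ ENNReal.ofReal (∫ x, H x) := by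
  rw [klDiv_withDensity_gaussianReal hq hm, ofReal_integral_eq_lintegral_ofReal hH
    (Filter.Eventually.of_forall fun x => le_trans (mul_nonneg (gaussianPDFReal_nonneg _ _ _)
      (klFun_nonneg (div_nonneg (hq x) (gaussianPDFReal_nonneg _ _ _)))) (h x))]
  exact lintegral_mono fun x => ENNReal.ofReal_le_ofReal (h x)

lemma gaussian_integral_eq {h : ℝ → ℝ} (m : ℝ) :
    ∫ x, h x * gaussianPDFReal m 1 x = ∫ x, h x ∂(gaussianReal m 1) := by
  rw [integral_gaussianReal_eq_integral_smul one_ne_zero]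
  simp [mul_comm]

lemma integrable_mul_gaussianPDFReal_iff {h : ℝ → ℝ} (m : ℝ) :
    Integrable (fun x => h x * gaussianPDFReal m 1 x) ↔ Integrable h (gaussianReal m 1) := by
  rw [gaussianReal_of_var_ne_zero m one_ne_zero]
  exact (integrable_withDensity_ofReal_iff (gaussianPDFReal_nonneg m 1)
    (measurable_gaussianPDFReal m 1)).symm

lemma integrable_sub_pow_gaussianReal (m : ℝ) (k : ℕ) :
    Integrable (fun x => (x - m) ^ k) (gaussianReal m 1) := by
  have h : MemLp (fun x : ℝ => x - m) k (gaussianReal m 1) :=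
    (memLp_id_gaussianReal k).sub (memLp_const m)
  rw [← integrable_norm_iff (Continuous.aestronglyMeasurable (by fun_prop))]
  simpa using h.integrable_norm_pow'

lemma integral_sub_pow_gaussianReal (m : ℝ) (k : ℕ) :
    ∫ x, (x - m) ^ k ∂(gaussianReal m 1) = ∫ x, x ^ k ∂(gaussianReal 0 1) := by
  have h := gaussianReal_map_add_const (μ := 0) (v := 1) m
  rw [zero_add] at h
  rw [← h, integral_map (by fun_prop) (Continuous.aestronglyMeasurable (by fun_prop))]
  simp

lemma integral_sub_sq_gaussianReal (m : ℝ) :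
    ∫ x, (x - m) ^ 2 ∂(gaussianReal m 1) = 1 := by
  have h := variance_id_gaussianReal (μ := m) (v := 1)
  rw [variance_eq_integral aemeasurable_id] at h
  simpa using h

variable {q : ℝ → ℝ} {K m : ℝ}

/-- The logarithm of the Gaussian density is quadratic, so the upper bound on `q` and its second
moment already control the divergence. -/
lemma klDiv_gaussianReal_le_log (hq : ∀ x, 0 ≤ q x) (hm : Measurable q)
    [IsProbabilityMeasure (volume.withDensity fun x => ENNReal.ofReal (q x))]
    (hqK : ∀ x, q x ≤ K) (hi2 : Integrable fun x => (x - m) ^ 2 * q x)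
    (hvar : ∫ x, (x - m) ^ 2 * q x = 1) :
    klDiv (volume.withDensity fun x => ENNReal.ofReal (q x)) (gaussianReal m 1)
      ≤ ENNReal.ofReal (3 + Real.log K) := by
  have hi := integrable_of_withDensity_isFiniteMeasure hq hm
  have h1 := integral_eq_one_of_withDensity hq hm
  have hφi := integrable_gaussianPDFReal m 1
  have hI0 : Integrable fun x => (Real.log K + 1) * q x + (1 / 2) * ((x - m) ^ 2 * q x) :=
    (hi.const_mul _).add (hi2.const_mul _)
  have hI : Integrable fun x => (Real.log K + 1) * q x + (1 / 2) * ((x - m) ^ 2 * q x)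
      + gaussianPDFReal m 1 x :=
    hI0.add hφi
  refine (klDiv_withDensity_gaussianReal_le hq hm m hI fun x => ?_).trans
    (ENNReal.ofReal_le_ofReal ?_)
  · have := mul_klFun_div_le_add (gaussianPDFReal_pos m 1 x one_ne_zero) (hq x) (hqK x)
      (neg_log_gaussianPDFReal_le m x)
    linarith
  · rw [integral_add hI0 hφi,
      integral_add (hi.const_mul _) (hi2.const_mul _), integral_const_mul, integral_const_mul,
      h1, hvar, integral_gaussianPDFReal_eq_one m one_ne_zero]
    linarith

/-- A uniform bound on the difference of the densities controls the divergence. -/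
lemma klDiv_gaussianReal_le_sqrt (hq : ∀ x, 0 ≤ q x) (hm : Measurable q)
    [IsProbabilityMeasure (volume.withDensity fun x => ENNReal.ofReal (q x))]
    (hK : 1 ≤ K) (hqK : ∀ x, q x ≤ K) (hi2 : Integrable fun x => (x - m) ^ 2 * q x)
    (hvar : ∫ x, (x - m) ^ 2 * q x = 1) {η : ℝ} (hη0 : 0 < η) (hη1 : η ≤ 1)
    (hη : ∀ x, |q x - gaussianPDFReal m 1 x| ≤ η) :
    klDiv (volume.withDensity fun x => ENNReal.ofReal (q x)) (gaussianReal m 1)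
      ≤ ENNReal.ofReal ((4 + 2 * ∫ x, x ^ 6 ∂(gaussianReal 0 1)) * (3 + Real.log K) * √η) := by
  have hφi2 := (integrable_mul_gaussianPDFReal_iff m).2 (integrable_sub_pow_gaussianReal m 2)
  have hφi6 := (integrable_mul_gaussianPDFReal_iff m).2 (integrable_sub_pow_gaussianReal m 6)
  have hLK : 0 ≤ Real.log K := Real.log_nonneg hK
  set a := 3 + Real.log K with ha
  -- The window contributes order `T³ η` and the Gaussian tail order `T⁻⁴`. This choice makes the
  -- former exactly `√η` and the latter `η ^ (2 / 3) ≤ √η`.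
  set T : ℝ := η ^ (-(1 / 6) : ℝ) with hTdef
  have hT : 1 ≤ T := Real.one_le_rpow_of_pos_of_le_one_of_nonpos hη0 hη1 (by norm_num)
  have hT3 : T ^ 3 * η = √η := by
    rw [Real.sqrt_eq_rpow, hTdef, ← Real.rpow_natCast, ← Real.rpow_mul hη0.le]
    nth_rewrite 2 [← Real.rpow_one η]
    rw [← Real.rpow_add hη0]
    norm_num
  have hT4 : 1 / T ^ 4 ≤ √η := by
    rw [← hT3, div_le_iff₀ (by positivity)]
    have : T ^ 6 * η = 1 := by
      rw [hTdef, ← Real.rpow_natCast, ← Real.rpow_mul hη0.le]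
      nth_rewrite 2 [← Real.rpow_one η]
      rw [← Real.rpow_add hη0]
      norm_num
    have : T ^ 3 * η * T ^ 4 = T * (T ^ 6 * η) := by ring
    nlinarith
  set C6 := ∫ x, x ^ 6 ∂(gaussianReal 0 1)
  have hC6 : 0 ≤ C6 := integral_nonneg fun x => by positivity
  have hind : (fun x => (Set.Icc (-T) T).indicator (fun _ => 2 * a * T ^ 2 * η) (x - m))
      = (Set.Icc (m - T) (m + T)).indicator (fun _ => 2 * a * T ^ 2 * η) := by
    ext x
    have : x - m ∈ Set.Icc (-T) T ↔ x ∈ Set.Icc (m - T) (m + T) := by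
      simp only [Set.mem_Icc]; constructor <;> rintro ⟨h1, h2⟩ <;> constructor <;> linarith
    by_cases h : x ∈ Set.Icc (m - T) (m + T)
    · rw [Set.indicator_of_mem h, Set.indicator_of_mem (this.2 h)]
    · rw [Set.indicator_of_notMem h, Set.indicator_of_notMem (fun h' => h (this.1 h'))]
  have hI1 : Integrable fun x =>
      (Set.Icc (-T) T).indicator (fun _ => 2 * a * T ^ 2 * η) (x - m) := by
    rw [hind, integrable_indicator_iff measurableSet_Icc]
    exact continuousOn_const.integrableOn_Icc
  have hV1 : ∫ x, (Set.Icc (-T) T).indicator (fun _ => 2 * a * T ^ 2 * η) (x - m)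
      = 4 * a * (T ^ 3 * η) := by
    rw [hind, integral_indicator measurableSet_Icc, setIntegral_const]
    simp only [Real.volume_real_Icc, smul_eq_mul]
    rw [max_eq_left (by linarith)]
    ring
  have hI0 : Integrable fun x => (x - m) ^ 2 * q x - (x - m) ^ 2 * gaussianPDFReal m 1 x :=
    hi2.sub hφi2
  have hI2 : Integrable fun x => a * ((x - m) ^ 2 * q x - (x - m) ^ 2 * gaussianPDFReal m 1 x
      + 2 / T ^ 4 * ((x - m) ^ 6 * gaussianPDFReal m 1 x)) :=
    (hI0.add (hφi6.const_mul _)).const_mul _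
  have hV2 : ∫ x, a * ((x - m) ^ 2 * q x - (x - m) ^ 2 * gaussianPDFReal m 1 x
      + 2 / T ^ 4 * ((x - m) ^ 6 * gaussianPDFReal m 1 x)) = 2 * a * C6 * (1 / T ^ 4) := by
    rw [integral_const_mul, integral_add hI0 (hφi6.const_mul _),
      integral_sub hi2 hφi2, integral_const_mul, hvar, gaussian_integral_eq, gaussian_integral_eq,
      integral_sub_sq_gaussianReal, integral_sub_pow_gaussianReal]
    ring
  refine (klDiv_withDensity_gaussianReal_le hq hm m (hI1.add hI2) fun x => ?_).trans
    (ENNReal.ofReal_le_ofReal ?_)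
  · exact mul_klFun_div_le_truncated (gaussianPDFReal_pos m 1 x one_ne_zero) (hq x) (hqK x) hK
      (neg_log_gaussianPDFReal_le m x) (hη x) hT
  · simp only [Pi.add_apply]
    rw [integral_add hI1 hI2, hV1, hV2, hT3]
    have : 2 * a * C6 * (1 / T ^ 4) ≤ 2 * a * C6 * √η :=
      mul_le_mul_of_nonneg_left hT4 (by positivity)
    linarith

end Divergence

/-! ### Fourier inversion for densities. -/

section Fourier

open FourierTransform

/-- Mathlib's Fourier kernel is `exp (-2 π i v w)`, so the transform of `q` at `w` is `charFun μ (-2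
π w)`; undoing this dilation produces the factor `1 / (2 π)`. -/
lemma density_eq_integral_charFun {q : ℝ → ℝ} {μ : Measure ℝ} (hq : ∀ x, 0 ≤ q x)
    (hc : Continuous q) (hμ : μ = volume.withDensity fun x => ENNReal.ofReal (q x))
    [IsFiniteMeasure μ] (hi : Integrable (charFun μ)) (x : ℝ) :
    (q x : ℂ) = ((2 * Real.pi)⁻¹ : ℝ) •
      ∫ t, Complex.exp ((-(t * x) : ℝ) * Complex.I) * charFun μ t := by
  have hqi : Integrable q := by
    subst hμ; exact integrable_of_withDensity_isFiniteMeasure hq hc.measurable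
  have hF : 𝓕 (fun x => (q x : ℂ)) = fun w => charFun μ (-(2 * Real.pi) * w) := by
    ext w
    rw [Real.fourier_real_eq_integral_exp_smul, charFun_apply_real, hμ,
      integral_withDensity_ofReal hq hc.measurable]
    congr 1 with v
    rw [Complex.real_smul, smul_eq_mul, mul_comm]
    congr 2
    push_cast
    ring
  have hpi : -(2 * Real.pi) ≠ 0 := by have := Real.pi_pos; linarith
  have h := Continuous.fourierInv_fourier_eq (f := fun x => (q x : ℂ)) (by fun_prop)
    hqi.ofReal (by rw [hF]; exact hi.comp_mul_left' hpi)
  have h2 := congrFun h x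
  rw [hF, Real.fourierInv_eq'] at h2
  rw [← h2]
  have h3 := Measure.integral_comp_mul_left
    (fun t => Complex.exp ((-(t * x) : ℝ) * Complex.I) * charFun μ t) (-(2 * Real.pi))
  rw [inv_neg, abs_neg, abs_of_pos (by positivity)] at h3
  rw [← h3]
  congr 1 with t
  rw [smul_eq_mul]
  congr 3
  simp
  ring

lemma inv_two_pi_le_one : (2 * Real.pi)⁻¹ ≤ 1 := by
  have := Real.pi_gt_three
  exact inv_le_one_of_one_le₀ (by linarith)

lemma integrable_exp_mul_charFun {μ : Measure ℝ} (hi : Integrable (charFun μ)) (x : ℝ) :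
    Integrable fun t => Complex.exp ((-(t * x) : ℝ) * Complex.I) * charFun μ t :=
  hi.bdd_mul (c := 1) (Continuous.aestronglyMeasurable (by fun_prop))
    (Filter.Eventually.of_forall fun t => by rw [Complex.norm_exp_ofReal_mul_I])

lemma density_le_integral_norm_charFun {q : ℝ → ℝ} {μ : Measure ℝ} (hq : ∀ x, 0 ≤ q x)
    (hc : Continuous q) (hμ : μ = volume.withDensity fun x => ENNReal.ofReal (q x))
    [IsFiniteMeasure μ] (hi : Integrable (charFun μ)) (x : ℝ) :
    q x ≤ ∫ t, ‖charFun μ t‖ := by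
  have h := congrArg norm (density_eq_integral_charFun hq hc hμ hi x)
  rw [Complex.norm_real, Real.norm_eq_abs, abs_of_nonneg (hq x), norm_smul, Real.norm_eq_abs,
    abs_of_pos (by positivity)] at h
  rw [h]
  refine (mul_le_of_le_one_left (norm_nonneg _) inv_two_pi_le_one).trans
    ((norm_integral_le_integral_norm _).trans (le_of_eq ?_))
  simp only [norm_mul, Complex.norm_exp_ofReal_mul_I, one_mul]

lemma abs_density_sub_le_integral_norm_charFun_sub {q₁ q₂ : ℝ → ℝ} {μ₁ μ₂ : Measure ℝ}
    (hq₁ : ∀ x, 0 ≤ q₁ x) (hc₁ : Continuous q₁)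
    (hμ₁ : μ₁ = volume.withDensity fun x => ENNReal.ofReal (q₁ x)) [IsFiniteMeasure μ₁]
    (hi₁ : Integrable (charFun μ₁)) (hq₂ : ∀ x, 0 ≤ q₂ x) (hc₂ : Continuous q₂)
    (hμ₂ : μ₂ = volume.withDensity fun x => ENNReal.ofReal (q₂ x)) [IsFiniteMeasure μ₂]
    (hi₂ : Integrable (charFun μ₂)) (x : ℝ) :
    |q₁ x - q₂ x| ≤ ∫ t, ‖charFun μ₁ t - charFun μ₂ t‖ := by
  have h : ((q₁ x - q₂ x : ℝ) : ℂ) = ((2 * Real.pi)⁻¹ : ℝ) •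
      ∫ t, Complex.exp ((-(t * x) : ℝ) * Complex.I) * (charFun μ₁ t - charFun μ₂ t) := by
    simp only [mul_sub]
    rw [integral_sub (integrable_exp_mul_charFun hi₁ x) (integrable_exp_mul_charFun hi₂ x),
      smul_sub, ← density_eq_integral_charFun hq₁ hc₁ hμ₁ hi₁ x,
      ← density_eq_integral_charFun hq₂ hc₂ hμ₂ hi₂ x]
    simp
  have h := congrArg norm h
  rw [Complex.norm_real, Real.norm_eq_abs, norm_smul, Real.norm_eq_abs,
    abs_of_pos (by positivity : 0 < (2 * Real.pi)⁻¹)] at h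
  rw [h]
  refine (mul_le_of_le_one_left (norm_nonneg _) inv_two_pi_le_one).trans
    ((norm_integral_le_integral_norm _).trans (le_of_eq ?_))
  simp only [norm_mul, Complex.norm_exp_ofReal_mul_I, one_mul]

end Fourier

/-! ### Comparison with the Gaussian at low frequencies. -/

section CharFunApproximation

lemma norm_cexp_sub_taylor_two_le (x : ℝ) :
    ‖Complex.exp (x * Complex.I) - (1 + x * Complex.I - x ^ 2 / 2)‖ ≤ 4 * |x| ^ 3 := by
  rcases le_total |x| 1 with h | h
  · have hn : ‖(x : ℂ) * Complex.I‖ = |x| := by simp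
    have := Complex.exp_bound (x := x * Complex.I) (by rw [hn]; exact h) (n := 3) (by norm_num)
    rw [hn] at this
    have he : ∑ m ∈ Finset.range 3, ((x : ℂ) * Complex.I) ^ m / (m.factorial : ℂ)
        = 1 + x * Complex.I - x ^ 2 / 2 := by
      simp [Finset.sum_range_succ, Nat.factorial, mul_pow]
      ring
    rw [he] at this
    refine this.trans ?_
    have : 0 ≤ |x| ^ 3 := by positivity
    norm_num [Nat.factorial]
    linarith
  · have h2 : ‖Complex.exp (x * Complex.I) - (1 + x * Complex.I - x ^ 2 / 2)‖
        ≤ 1 + (1 + |x| + |x| ^ 2 / 2) := by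
      refine (norm_sub_le _ _).trans ?_
      rw [Complex.norm_exp_ofReal_mul_I]
      gcongr
      refine (norm_sub_le _ _).trans ?_
      gcongr
      · refine (norm_add_le _ _).trans ?_
        simp
      · simp
    have h3 : 1 ≤ |x| ^ 3 := one_le_pow₀ h
    have h4 : |x| ≤ |x| ^ 3 := by nlinarith [sq_nonneg |x|]
    have h5 : |x| ^ 2 ≤ |x| ^ 3 := by nlinarith [sq_nonneg |x|]
    linarith

lemma norm_charFun_sub_le {μ : Measure ℝ} [IsProbabilityMeasure μ] {v β : ℝ}
    (h1 : ∫ x, x ∂μ = 0) (h2 : ∫ x, x ^ 2 ∂μ = v) (hi : MemLp id 3 μ)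
    (h3 : ∫ x, |x| ^ 3 ∂μ ≤ β) (t : ℝ) :
    ‖charFun μ t - ((1 - v * t ^ 2 / 2 : ℝ) : ℂ)‖ ≤ 4 * (β * |t| ^ 3) := by
  have i1 : Integrable (fun x : ℝ => x) μ := (hi.mono_exponent (by norm_num)).integrable le_rfl
  have i2 : Integrable (fun x : ℝ => x ^ 2) μ :=
    (hi.mono_exponent (p := 2) (by norm_num)).integrable_sq
  have i3 : Integrable (fun x : ℝ => |x| ^ 3) μ := by
    simpa using hi.integrable_norm_pow (p := 3) (by norm_num)
  have ie : Integrable (fun x : ℝ => Complex.exp (((t * x : ℝ) : ℂ) * Complex.I)) μ := by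
    refine Integrable.of_bound (C := 1) (Continuous.aestronglyMeasurable (by fun_prop))
      (Filter.Eventually.of_forall fun x => by rw [Complex.norm_exp_ofReal_mul_I])
  have ia : Integrable (fun x : ℝ => 1 + (x : ℂ) * (t * Complex.I)) μ :=
    (integrable_const _).add (i1.ofReal.mul_const _)
  have ib : Integrable (fun x : ℝ => ((x ^ 2 : ℝ) : ℂ) * (t ^ 2 / 2)) μ := i2.ofReal.mul_const _
  have he : charFun μ t - ((1 - v * t ^ 2 / 2 : ℝ) : ℂ)
      = ∫ x, (Complex.exp (((t * x : ℝ) : ℂ) * Complex.I)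
        - (1 + (x : ℂ) * (t * Complex.I) - ((x ^ 2 : ℝ) : ℂ) * (t ^ 2 / 2))) ∂μ := by
    have iab : Integrable (fun x : ℝ =>
        1 + (x : ℂ) * (t * Complex.I) - ((x ^ 2 : ℝ) : ℂ) * (t ^ 2 / 2)) μ := ia.sub ib
    rw [integral_sub ie iab, integral_sub ia ib, integral_add (integrable_const _)
      (i1.ofReal.mul_const _), integral_mul_const, integral_mul_const, integral_complex_ofReal,
      integral_complex_ofReal, h1, h2, charFun_apply_real]
    simp
    ring
  rw [he]
  calc ‖∫ x, (Complex.exp (((t * x : ℝ) : ℂ) * Complex.I)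
        - (1 + (x : ℂ) * (t * Complex.I) - ((x ^ 2 : ℝ) : ℂ) * (t ^ 2 / 2))) ∂μ‖
      ≤ ∫ x, 4 * |t| ^ 3 * |x| ^ 3 ∂μ := by
        refine norm_integral_le_of_norm_le (i3.const_mul _)
          (Filter.Eventually.of_forall fun x => ?_)
        have := norm_cexp_sub_taylor_two_le (t * x)
        rw [abs_mul, mul_pow, ← mul_assoc] at this
        refine le_trans (le_of_eq ?_) this
        congr 2
        push_cast
        ring
    _ = 4 * |t| ^ 3 * ∫ x, |x| ^ 3 ∂μ := integral_const_mul _ _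
    _ ≤ 4 * |t| ^ 3 * β := by gcongr
    _ = _ := by ring

/-- Applied with `y = v t² / 2` and `z = β |t|³`, where `y³ ≤ z²` follows from the moment inequality
`v³ ≤ β²`. The error is at most `y²` if `y ≤ 1` and at most `y` if `y ≥ 1`; the hypothesis bounds
either by `z`. -/
lemma abs_exp_neg_sub_le {y z : ℝ} (hy : 0 ≤ y) (hz : 0 ≤ z) (h : y ^ 3 ≤ z ^ 2) :
    |Real.exp (-y) - (1 - y)| ≤ z := by
  have h1 : 1 - y ≤ Real.exp (-y) := by have := Real.add_one_le_exp (-y); linarith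
  rw [abs_of_nonneg (by linarith)]
  rcases le_total y 1 with hy1 | hy1
  · have h2 : Real.exp (-y) ≤ 1 - y + y ^ 2 := by
      rw [Real.exp_neg]
      refine inv_le_of_inv_le₀ (by nlinarith) ?_
      refine le_trans ?_ (Real.add_one_le_exp y)
      rw [inv_le_iff_one_le_mul₀ (by nlinarith)]
      nlinarith [pow_nonneg hy 3]
    have h3 : y ^ 2 ≤ z := by
      refine le_of_sq_le_sq ?_ hz
      nlinarith [pow_nonneg hy 3]
    linarith
  · have h2 : Real.exp (-y) ≤ 1 := Real.exp_le_one_iff.2 (by linarith)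
    have h3 : y ≤ z := by
      refine le_of_sq_le_sq ?_ hz
      nlinarith [sq_nonneg y]
    linarith

/-- For `y ≤ 1` this is the triangle inequality and `1 + x ≤ exp x`; for `y ≥ 1` the hypothesis
forces `y ≤ z`, and the right-hand side is at least 1. -/
lemma norm_le_exp_of_norm_sub_le {a : ℂ} {y z : ℝ} (ha : ‖a‖ ≤ 1) (hz : 0 ≤ z)
    (h : y ^ 3 ≤ z ^ 2) (hd : ‖a - ((1 - y : ℝ) : ℂ)‖ ≤ 4 * z) :
    ‖a‖ ≤ Real.exp (-y + 4 * z) := by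
  rcases le_total y 1 with hy1 | hy1
  · have h1 : ‖a‖ ≤ ‖a - ((1 - y : ℝ) : ℂ)‖ + ‖((1 - y : ℝ) : ℂ)‖ := by
      simpa using norm_add_le (a - ((1 - y : ℝ) : ℂ)) ((1 - y : ℝ) : ℂ)
    rw [Complex.norm_real, Real.norm_eq_abs, abs_of_nonneg (by linarith)] at h1
    have := Real.add_one_le_exp (-y + 4 * z)
    linarith
  · have h3 : y ≤ z := by
      refine le_of_sq_le_sq ?_ hz
      nlinarith [sq_nonneg y]
    exact ha.trans (Real.one_le_exp (by linarith))

lemma norm_prod_sub_prod_le {ι : Type*} (s : Finset ι) (a b : ι → ℂ)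
    (ha : ∀ i ∈ s, ‖a i‖ ≤ 1) (hb : ∀ i ∈ s, ‖b i‖ ≤ 1) :
    ‖∏ i ∈ s, a i - ∏ i ∈ s, b i‖ ≤ ∑ i ∈ s, ‖a i - b i‖ := by
  classical
  induction s using Finset.induction_on with
  | empty => simp
  | insert i s hi ih =>
    rw [Finset.prod_insert hi, Finset.prod_insert hi, Finset.sum_insert hi]
    have ih' := ih (fun j hj => ha j (Finset.mem_insert_of_mem hj))
      (fun j hj => hb j (Finset.mem_insert_of_mem hj))
    have h1 : ‖∏ j ∈ s, a j‖ ≤ 1 := by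
      rw [norm_prod]
      exact Finset.prod_le_one (fun j _ => norm_nonneg _)
        fun j hj => ha j (Finset.mem_insert_of_mem hj)
    have h2 := hb i (Finset.mem_insert_self i s)
    have e : a i * ∏ j ∈ s, a j - b i * ∏ j ∈ s, b j
        = (a i - b i) * ∏ j ∈ s, a j + b i * (∏ j ∈ s, a j - ∏ j ∈ s, b j) := by ring
    rw [e]
    refine (norm_add_le _ _).trans ?_
    rw [norm_mul, norm_mul]
    exact add_le_add (mul_le_of_le_one_right (norm_nonneg _) h1)
      ((mul_le_of_le_one_left (norm_nonneg _) h2).trans ih')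

/-- The telescoping bound applied to the factors divided by `c i`. Keeping the product of the `c i`
in front preserves the Gaussian decay. -/
lemma norm_prod_sub_prod_le_of_norm_le {ι : Type*} (s : Finset ι) (a b : ι → ℂ) (c : ι → ℝ)
    (hc : ∀ i ∈ s, 0 < c i) (ha : ∀ i ∈ s, ‖a i‖ ≤ c i) (hb : ∀ i ∈ s, ‖b i‖ ≤ c i) :
    ‖∏ i ∈ s, a i - ∏ i ∈ s, b i‖ ≤ (∏ i ∈ s, c i) * ∑ i ∈ s, ‖a i - b i‖ / c i := by
  have hP : 0 < ∏ i ∈ s, c i := Finset.prod_pos hc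
  have hnorm : ∀ i ∈ s, ∀ z : ℂ, ‖z / (c i : ℂ)‖ = ‖z‖ / c i := fun i hi z => by
    rw [norm_div, Complex.norm_real, Real.norm_eq_abs, abs_of_pos (hc i hi)]
  have h := norm_prod_sub_prod_le s (fun i => a i / c i) (fun i => b i / c i)
    (fun i hi => by rw [hnorm i hi]; exact (div_le_one (hc i hi)).2 (ha i hi))
    (fun i hi => by rw [hnorm i hi]; exact (div_le_one (hc i hi)).2 (hb i hi))
  have e : ∑ i ∈ s, ‖a i / c i - b i / c i‖ = ∑ i ∈ s, ‖a i - b i‖ / c i :=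
    Finset.sum_congr rfl fun i hi => by rw [← sub_div, hnorm i hi]
  rw [e, Finset.prod_div_distrib, Finset.prod_div_distrib, ← sub_div, norm_div,
    ← Complex.ofReal_prod, Complex.norm_real, Real.norm_eq_abs, abs_of_pos hP,
    div_le_iff₀ hP] at h
  linarith

/-- Comparison of the characteristic function of a sum with the Gaussian one, at low
frequencies. -/
lemma norm_prod_charFun_sub_exp_le {n : ℕ} {μ : Fin n → Measure ℝ}
    [∀ i, IsProbabilityMeasure (μ i)] {v β : Fin n → ℝ} {Λ t : ℝ}
    (h1 : ∀ i, ∫ x, x ∂(μ i) = 0) (h2 : ∀ i, ∫ x, x ^ 2 ∂(μ i) = v i)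
    (hi : ∀ i, MemLp id 3 (μ i)) (h3 : ∀ i, ∫ x, |x| ^ 3 ∂(μ i) ≤ β i)
    (hvβ : ∀ i, v i ^ 3 ≤ β i ^ 2) (hβ : ∀ i, 0 ≤ β i) (hv : ∑ i, v i = 1)
    (hΛ : ∑ i, β i ≤ Λ) (hΛ1 : Λ ≤ 1 / 64) (ht : 16 * Λ * |t| ≤ 1) :
    ‖∏ i, charFun (μ i) t - ((Real.exp (-t ^ 2 / 2) : ℝ) : ℂ)‖
      ≤ 5 * Λ * |t| ^ 3 * Real.exp (-t ^ 2 / 8) := by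
  have hv0 : ∀ i, 0 ≤ v i := fun i => by rw [← h2]; exact integral_nonneg fun x => sq_nonneg x
  -- From `v³ ≤ β² ≤ 64⁻² = 16⁻³`. No summand dominates, so dividing by one factor `c i` below costs
  -- at most `exp (t² / 8)`.
  have hv1 : ∀ i, v i ≤ 1 / 16 := fun i => by
    by_contra! hlt
    have hb : β i ≤ 1 / 64 :=
      (Finset.single_le_sum (fun j _ => hβ j) (Finset.mem_univ i)).trans (hΛ.trans hΛ1)
    have h4 : (1 / 16 : ℝ) ^ 3 < v i ^ 3 := pow_lt_pow_left₀ hlt (by norm_num) (by norm_num)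
    have := hvβ i
    have := hβ i
    nlinarith
  set y : Fin n → ℝ := fun i => v i * t ^ 2 / 2
  set z : Fin n → ℝ := fun i => β i * |t| ^ 3 with hz
  have hy0 : ∀ i, 0 ≤ y i := fun i => by have := hv0 i; positivity
  have hz0 : ∀ i, 0 ≤ z i := fun i => by have := hβ i; positivity
  have hyz : ∀ i, y i ^ 3 ≤ z i ^ 2 := fun i => by
    have e1 : y i ^ 3 = v i ^ 3 * t ^ 6 / 8 := by simp only [y]; ring
    have e2 : z i ^ 2 = β i ^ 2 * t ^ 6 := by
      simp only [hz]
      rw [mul_pow, ← pow_mul, show 3 * 2 = 6 from rfl, (by decide : Even 6).pow_abs]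
    rw [e1, e2]
    have h5 := mul_le_mul_of_nonneg_right (hvβ i) (by positivity : 0 ≤ t ^ 6)
    have h6 : 0 ≤ v i ^ 3 * t ^ 6 := mul_nonneg (pow_nonneg (hv0 i) 3) (by positivity)
    linarith
  have hd := fun i => norm_charFun_sub_le (h1 i) (h2 i) (hi i) (h3 i) t
  have hE := fun i => abs_exp_neg_sub_le (hy0 i) (hz0 i) (hyz i)
  have hb : ∏ i, ((Real.exp (-y i) : ℝ) : ℂ) = ((Real.exp (-t ^ 2 / 2) : ℝ) : ℂ) := by
    rw [← Complex.ofReal_prod, ← Real.exp_sum, Finset.sum_neg_distrib]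
    simp only [y]
    rw [← Finset.sum_div, ← Finset.sum_mul, hv]
    congr 2
    ring
  have hab : ∀ i, ‖charFun (μ i) t - ((Real.exp (-y i) : ℝ) : ℂ)‖ ≤ 5 * z i := fun i => by
    have e : charFun (μ i) t - ((Real.exp (-y i) : ℝ) : ℂ)
        = (charFun (μ i) t - ((1 - y i : ℝ) : ℂ)) - ((Real.exp (-y i) - (1 - y i) : ℝ) : ℂ) := by
      push_cast; ring
    rw [e]
    refine (norm_sub_le _ _).trans ?_
    rw [Complex.norm_real, Real.norm_eq_abs]
    have := hd i
    have := hE i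
    linarith
  have hmain := norm_prod_sub_prod_le_of_norm_le Finset.univ (fun i => charFun (μ i) t)
    (fun i => ((Real.exp (-y i) : ℝ) : ℂ)) (fun i => Real.exp (-y i + 4 * z i))
    (fun i _ => Real.exp_pos _)
    (fun i _ => norm_le_exp_of_norm_sub_le (norm_charFun_le_one t) (hz0 i) (hyz i) (hd i))
    (fun i _ => by
      rw [Complex.norm_real, Real.norm_eq_abs, abs_of_pos (Real.exp_pos _)]
      exact Real.exp_le_exp.2 (by have := hz0 i; linarith))
  rw [hb] at hmain
  have hz_sum : ∑ i, z i ≤ Λ * |t| ^ 3 := by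
    simp only [hz]
    rw [← Finset.sum_mul]
    exact mul_le_mul_of_nonneg_right hΛ (by positivity)
  -- The restriction `16 Λ |t| ≤ 1` makes the cubic error `4 Λ |t|³` at most half of the Gaussian
  -- exponent `t² / 2`.
  have hc : ∏ i, Real.exp (-y i + 4 * z i) ≤ Real.exp (-t ^ 2 / 4) := by
    rw [← Real.exp_sum, Finset.sum_add_distrib, Finset.sum_neg_distrib, ← Finset.mul_sum]
    refine Real.exp_le_exp.2 ?_
    have e1 : ∑ i, y i = t ^ 2 / 2 := by
      simp only [y]; rw [← Finset.sum_div, ← Finset.sum_mul, hv]; ring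
    have e2 : 4 * (Λ * |t| ^ 3) ≤ t ^ 2 / 4 := by
      have : 4 * (Λ * |t| ^ 3) = (16 * Λ * |t|) * |t| ^ 2 / 4 := by ring
      rw [this, sq_abs]
      have := mul_le_mul_of_nonneg_right ht (sq_nonneg t)
      linarith
    rw [e1]
    linarith
  have hs : ∑ i, ‖charFun (μ i) t - ((Real.exp (-y i) : ℝ) : ℂ)‖ / Real.exp (-y i + 4 * z i)
      ≤ 5 * (Λ * |t| ^ 3) * Real.exp (t ^ 2 / 8) := by
    calc ∑ i, ‖charFun (μ i) t - ((Real.exp (-y i) : ℝ) : ℂ)‖ / Real.exp (-y i + 4 * z i)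
        ≤ ∑ i, 5 * z i * Real.exp (t ^ 2 / 8) := by
          refine Finset.sum_le_sum fun i _ => ?_
          rw [div_eq_mul_inv, ← Real.exp_neg]
          refine mul_le_mul (hab i) (Real.exp_le_exp.2 ?_) (Real.exp_pos _).le
            (by have := hz0 i; positivity)
          have h7 : y i ≤ t ^ 2 / 8 := by
            simp only [y]
            have := mul_le_mul_of_nonneg_right (hv1 i) (sq_nonneg t)
            nlinarith [sq_nonneg t]
          have := hz0 i
          linarith
      _ = 5 * (∑ i, z i) * Real.exp (t ^ 2 / 8) := by
          rw [Finset.mul_sum, Finset.sum_mul]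
      _ ≤ _ := by gcongr
  refine hmain.trans ?_
  calc (∏ i, Real.exp (-y i + 4 * z i)) *
        ∑ i, ‖charFun (μ i) t - ((Real.exp (-y i) : ℝ) : ℂ)‖ / Real.exp (-y i + 4 * z i)
      ≤ Real.exp (-t ^ 2 / 4) * (5 * (Λ * |t| ^ 3) * Real.exp (t ^ 2 / 8)) :=
        mul_le_mul hc hs (Finset.sum_nonneg fun i _ => by positivity) (Real.exp_pos _).le
    _ = 5 * Λ * |t| ^ 3 * (Real.exp (-t ^ 2 / 4) * Real.exp (t ^ 2 / 8)) := by ring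
    _ = _ := by
        rw [← Real.exp_add]
        congr 2
        ring

end CharFunApproximation

/-! ### Integrating the comparison over all frequencies. -/

section CharFunIntegral

lemma integrable_inv_one_add_div_sq {c : ℝ} (hc : 0 < c) :
    Integrable fun t : ℝ => (1 + (t / c) ^ 2)⁻¹ :=
  integrable_inv_one_add_sq.comp_div hc.ne'

lemma integral_inv_one_add_div_sq {c : ℝ} (hc : 0 < c) :
    ∫ t : ℝ, (1 + (t / c) ^ 2)⁻¹ = c * Real.pi := by
  rw [Measure.integral_comp_div (fun t : ℝ => (1 + t ^ 2)⁻¹) c, integral_univ_inv_one_add_sq,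
    abs_of_pos hc, smul_eq_mul]

lemma integrable_abs_pow_mul_exp {a : ℝ} (ha : 0 < a) (k : ℕ) :
    Integrable fun t : ℝ => |t| ^ k * Real.exp (-t ^ 2 / a) := by
  have h := integrable_rpow_mul_exp_neg_mul_sq (b := 1 / a) (by positivity) (s := k)
    (by have : (0 : ℝ) ≤ k := Nat.cast_nonneg k; linarith)
  refine h.norm.congr (Filter.Eventually.of_forall fun t => ?_)
  simp only [norm_mul, Real.rpow_natCast, norm_pow, Real.norm_eq_abs, Real.abs_exp]
  congr 2
  ring

variable {f : ℝ → ℂ} {b : ℝ}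

lemma inv_sq_le_inv (u : ℝ) : ((1 + u ^ 2) ^ 2)⁻¹ ≤ (1 + u ^ 2)⁻¹ := by
  refine inv_anti₀ (by positivity) ?_
  nlinarith [sq_nonneg u]

lemma integrable_of_norm_le_inv_sq (hf : AEStronglyMeasurable f) (hb : 0 < b)
    (h : ∀ t, ‖f t‖ ≤ ((1 + (t / (2 * √b)) ^ 2) ^ 2)⁻¹) : Integrable f :=
  (integrable_inv_one_add_div_sq (by positivity : 0 < 2 * √b)).mono' hf
    (Filter.Eventually.of_forall fun t => (h t).trans (inv_sq_le_inv _))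

lemma integral_norm_le_of_norm_le_inv_sq (hf : AEStronglyMeasurable f) (hb : 0 < b)
    (h : ∀ t, ‖f t‖ ≤ ((1 + (t / (2 * √b)) ^ 2) ^ 2)⁻¹) : ∫ t, ‖f t‖ ≤ 2 * Real.pi * √b := by
  calc ∫ t, ‖f t‖ ≤ ∫ t, (1 + (t / (2 * √b)) ^ 2)⁻¹ :=
        integral_mono (integrable_of_norm_le_inv_sq hf hb h).norm
          (integrable_inv_one_add_div_sq (by positivity))
          fun t => (h t).trans (inv_sq_le_inv _)
    _ = 2 * Real.pi * √b := by rw [integral_inv_one_add_div_sq (by positivity)]; ring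

/-- Integrated comparison of a characteristic function with the Gaussian one. -/
lemma exists_integral_norm_sub_exp_le : ∃ C : ℝ, 0 < C ∧ ∀ (f g : ℝ → ℂ) (b Λ : ℝ),
    AEStronglyMeasurable f → AEStronglyMeasurable g → 1 ≤ b → 0 ≤ Λ →
    (∀ t, ‖f t‖ ≤ ((1 + (t / (2 * √b)) ^ 2) ^ 2)⁻¹) →
    (∀ t, ‖g t‖ ≤ Real.exp (-t ^ 2 / 2)) →
    (∀ t, 16 * Λ * |t| ≤ 1 → ‖f t - g t‖ ≤ 5 * Λ * |t| ^ 3 * Real.exp (-t ^ 2 / 8)) →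
    ∫ t, ‖f t - g t‖ ≤ C * (Λ * b) := by
  have i3 := integrable_abs_pow_mul_exp (a := 8) (by norm_num) 3
  have i1 := integrable_abs_pow_mul_exp (a := 2) (by norm_num) 1
  set C3 := ∫ t : ℝ, |t| ^ 3 * Real.exp (-t ^ 2 / 8)
  set C1 := ∫ t : ℝ, |t| ^ 1 * Real.exp (-t ^ 2 / 2)
  have hC3 : 0 ≤ C3 := integral_nonneg fun t => by positivity
  have hC1 : 0 ≤ C1 := integral_nonneg fun t => by positivity
  refine ⟨5 * C3 + 32 * Real.pi + 16 * C1, by positivity, ?_⟩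
  intro f g b Λ hf hg hb hΛ hfb hgb hlow
  have hsb : 0 < √b := Real.sqrt_pos.2 (by linarith)
  have ib := integrable_inv_one_add_div_sq (by positivity : 0 < 2 * √b)
  have hdom : Integrable fun t : ℝ => 5 * Λ * (|t| ^ 3 * Real.exp (-t ^ 2 / 8))
      + 16 * Λ * √b * (1 + (t / (2 * √b)) ^ 2)⁻¹ :=
    (i3.const_mul _).add (ib.const_mul _)
  have hdom' : Integrable fun t : ℝ => 5 * Λ * (|t| ^ 3 * Real.exp (-t ^ 2 / 8))
      + 16 * Λ * √b * (1 + (t / (2 * √b)) ^ 2)⁻¹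
      + 16 * Λ * (|t| ^ 1 * Real.exp (-t ^ 2 / 2)) :=
    hdom.add (i1.const_mul _)
  have hpt : ∀ t, ‖f t - g t‖ ≤ 5 * Λ * (|t| ^ 3 * Real.exp (-t ^ 2 / 8))
      + 16 * Λ * √b * (1 + (t / (2 * √b)) ^ 2)⁻¹
      + 16 * Λ * (|t| ^ 1 * Real.exp (-t ^ 2 / 2)) := by
    intro t
    have p1 : 0 ≤ 5 * Λ * (|t| ^ 3 * Real.exp (-t ^ 2 / 8)) := by positivity
    have p2 : 0 ≤ 16 * Λ * √b * (1 + (t / (2 * √b)) ^ 2)⁻¹ := by positivity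
    have p3 : 0 ≤ 16 * Λ * (|t| ^ 1 * Real.exp (-t ^ 2 / 2)) := by positivity
    rcases le_total (16 * Λ * |t|) 1 with ht | ht
    · have := hlow t ht
      rw [mul_assoc (5 * Λ)] at this
      linarith
    -- At high frequency `1 ≤ 16 Λ |t|`. One of the two powers of `1 + u²` absorbs `|t|`, through `2
    -- |u| ≤ 1 + u²`, and the other keeps the integral finite. The prefactor `√b` times the width `2
    -- √b` is the source of the factor `b`.
    · have h1 : ‖f t‖ ≤ 16 * Λ * √b * (1 + (t / (2 * √b)) ^ 2)⁻¹ := by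
        refine (hfb t).trans ?_
        set u := t / (2 * √b) with hu
        have htu : |t| = 2 * √b * |u| := by
          rw [hu, abs_div, abs_of_pos (by positivity : 0 < 2 * √b)]; field_simp
        have hA : 2 * |u| ≤ 1 + u ^ 2 := by
          rw [← sq_abs u]; nlinarith [sq_nonneg (|u| - 1)]
        rw [inv_le_iff_one_le_mul₀ (by positivity)]
        have e : 16 * Λ * √b * (1 + u ^ 2)⁻¹ * (1 + u ^ 2) ^ 2 = 16 * Λ * √b * (1 + u ^ 2) := by
          have : (1 + u ^ 2) ≠ 0 := by positivity
          field_simp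
        rw [e]
        calc (1 : ℝ) ≤ 16 * Λ * |t| := ht
          _ = 16 * Λ * √b * (2 * |u|) := by rw [htu]; ring
          _ ≤ _ := mul_le_mul_of_nonneg_left hA (by positivity)
      have h2 : ‖g t‖ ≤ 16 * Λ * (|t| ^ 1 * Real.exp (-t ^ 2 / 2)) := by
        refine (hgb t).trans ?_
        rw [pow_one, ← mul_assoc]
        exact le_mul_of_one_le_left (Real.exp_pos _).le ht
      have := norm_sub_le (f t) (g t)
      linarith
  calc ∫ t, ‖f t - g t‖ ≤ _ :=
        integral_mono (hdom'.mono' (hf.sub hg) (Filter.Eventually.of_forall hpt)).norm hdom' hpt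
    _ = 5 * Λ * C3 + 16 * Λ * √b * (2 * √b * Real.pi) + 16 * Λ * C1 := by
        rw [integral_add hdom (i1.const_mul _), integral_add (i3.const_mul _) (ib.const_mul _),
          integral_const_mul, integral_const_mul, integral_const_mul,
          integral_inv_one_add_div_sq (by positivity)]
    _ = Λ * (5 * C3) + 32 * Real.pi * (Λ * (√b * √b)) + Λ * (16 * C1) := by ring
    _ ≤ Λ * b * (5 * C3) + 32 * Real.pi * (Λ * b) + Λ * b * (16 * C1) := by
        rw [Real.mul_self_sqrt (by linarith)]
        have : Λ ≤ Λ * b := le_mul_of_one_le_right hΛ hb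
        gcongr
    _ = _ := by ring

end CharFunIntegral

/-! ### Moment bounds in terms of `A = M ^ (1 / k)`. -/

section Moments

variable {Ω : Type*} [MeasurableSpace Ω] {P : Measure Ω} [IsProbabilityMeasure P]
  {Y : Ω → ℝ} {k M : ℝ}

lemma memLp_of_integrable_abs_rpow (hY : Measurable Y) (hk : 1 ≤ k)
    (hi : Integrable (fun ω => |Y ω| ^ k) P) {q : ℕ} (hq : (q : ℝ) ≤ k) : MemLp Y q P := by
  have hk0 : 0 < k := by linarith
  have h : MemLp Y (ENNReal.ofReal k) P := by
    rw [← integrable_norm_rpow_iff hY.aestronglyMeasurable (by simpa using hk0) (by simp)]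
    simpa [ENNReal.toReal_ofReal hk0.le] using hi
  refine h.mono_exponent ?_
  rw [← ENNReal.ofReal_natCast]
  exact ENNReal.ofReal_le_ofReal hq

/-- Monotonicity of moments. -/
lemma integral_abs_pow_le (hY : Measurable Y) (hi : Integrable (fun ω => |Y ω| ^ k) P)
    (hM : ∫ ω, |Y ω| ^ k ∂P ≤ M) {q : ℕ} (hq1 : 1 ≤ q) (hq : (q : ℝ) ≤ k) :
    ∫ ω, |Y ω| ^ q ∂P ≤ (M ^ (1 / k)) ^ q := by
  have hq0 : (1 : ℝ) ≤ q := by exact_mod_cast hq1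
  have hk0 : 0 < k := by linarith
  have hp : 1 ≤ k / q := by rw [one_le_div (by linarith)]; exact hq
  have hL := memLp_of_integrable_abs_rpow hY (by linarith) hi hq
  have hiq : Integrable (fun ω => |Y ω| ^ q) P := by
    simpa using hL.integrable_norm_pow (by omega)
  have hI0 : 0 ≤ ∫ ω, |Y ω| ^ q ∂P := integral_nonneg fun ω => by positivity
  have e : ∀ ω, (|Y ω| ^ q) ^ (k / q) = |Y ω| ^ k := fun ω => by
    rw [← Real.rpow_natCast, ← Real.rpow_mul (abs_nonneg _)]
    congr 1
    field_simp
  have hJ := (convexOn_rpow hp).map_integral_le (μ := P) (f := fun ω => |Y ω| ^ q)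
    (continuousOn_id.rpow_const fun x _ => Or.inr (by linarith)) isClosed_Ici
    (Filter.Eventually.of_forall fun ω => by simp only [Set.mem_Ici]; positivity) hiq
    (hi.congr (Filter.Eventually.of_forall fun ω => (e ω).symm))
  simp only [e] at hJ
  have h2 := Real.rpow_le_rpow (Real.rpow_nonneg hI0 _) (hJ.trans hM)
    (by positivity : 0 ≤ q / k)
  rw [← Real.rpow_mul hI0] at h2
  have e2 : k / q * (q / k) = 1 := by field_simp
  rw [e2, Real.rpow_one] at h2
  have hM0 : 0 ≤ M := le_trans (integral_nonneg fun ω => by positivity) hM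
  rw [← Real.rpow_natCast, ← Real.rpow_mul hM0]
  rwa [one_div_mul_eq_div]

lemma variance_le_of_integral_abs_pow {A : ℝ} (hY : Measurable Y)
    (h2 : ∫ ω, |Y ω| ^ 2 ∂P ≤ A ^ 2) : variance Y P ≤ A ^ 2 := by
  refine (variance_le_expectation_sq hY.aestronglyMeasurable).trans ?_
  simpa using h2

/-- Convexity gives `|Y - m|³ ≤ 4 |Y|³ + 4 |m|³`, and `|m| ≤ A`. This is the origin of the 8 in the
Lyapunov ratio. -/
lemma integral_abs_sub_mean_pow_three_le {A : ℝ} (hL : MemLp Y 3 P)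
    (h1 : ∫ ω, |Y ω| ^ 1 ∂P ≤ A ^ 1) (h3 : ∫ ω, |Y ω| ^ 3 ∂P ≤ A ^ 3) :
    ∫ ω, |Y ω - ∫ ω', Y ω' ∂P| ^ 3 ∂P ≤ 8 * A ^ 3 := by
  set m := ∫ ω, Y ω ∂P
  have hm : |m| ≤ A := by
    simp only [pow_one] at h1
    exact (abs_integral_le_integral_abs).trans h1
  have i1 : Integrable (fun ω => |Y ω - m| ^ 3) P := by
    simpa using (hL.sub (memLp_const m)).integrable_norm_pow (by norm_num)
  have i2 : Integrable (fun ω => |Y ω| ^ 3) P := by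
    simpa using hL.integrable_norm_pow (by norm_num)
  have hm3 : |m| ^ 3 ≤ A ^ 3 := pow_le_pow_left₀ (abs_nonneg _) hm 3
  calc ∫ ω, |Y ω - m| ^ 3 ∂P ≤ ∫ ω, (4 * |Y ω| ^ 3 + 4 * |m| ^ 3) ∂P := by
        refine integral_mono i1 ((i2.const_mul _).add (integrable_const _)) fun ω => ?_
        have h4 : |Y ω - m| ≤ |Y ω| + |m| := abs_sub _ _
        have h5 := pow_le_pow_left₀ (abs_nonneg _) h4 3
        have := abs_nonneg (Y ω)
        have := abs_nonneg m
        simp only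
        nlinarith [mul_nonneg (add_nonneg (abs_nonneg (Y ω)) (abs_nonneg m))
          (sq_nonneg (|Y ω| - |m|))]
    _ = 4 * ∫ ω, |Y ω| ^ 3 ∂P + 4 * |m| ^ 3 := by
        rw [integral_add (i2.const_mul _) (integrable_const _), integral_const_mul]
        simp
    _ ≤ 8 * A ^ 3 := by linarith

end Moments

/-! ### Characteristic function of the normalized sum. -/

section NormalizedSum

variable {Ω : Type*} [MeasurableSpace Ω] {P : Measure Ω} {n : ℕ} {X : Fin n → Ω → ℝ}

lemma charFun_map_real {Y : Ω → ℝ} (hY : Measurable Y) (t : ℝ) :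
    charFun (P.map Y) t = ∫ ω, Complex.exp (t * Y ω * Complex.I) ∂P := by
  rw [charFun_apply_real, integral_map hY.aemeasurable
    (Continuous.aestronglyMeasurable (by fun_prop))]

lemma charFun_map_sub_div {Y : Ω → ℝ} (hY : Measurable Y) (a c t : ℝ) :
    charFun (P.map fun ω => (Y ω - a) / c) t
      = Complex.exp ((-(t * a / c) : ℝ) * Complex.I) * charFun (P.map Y) (t / c) := by
  rw [charFun_map_real (by fun_prop), charFun_map_real hY, ← integral_const_mul]
  congr 1 with ω
  rw [← Complex.exp_add]
  congr 1
  push_cast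
  ring

lemma norm_charFun_map_sub_div {Y : Ω → ℝ} (hY : Measurable Y) (a c t : ℝ) :
    ‖charFun (P.map fun ω => (Y ω - a) / c) t‖ = ‖charFun (P.map Y) (t / c)‖ := by
  rw [charFun_map_sub_div hY, norm_mul, Complex.norm_exp_ofReal_mul_I, one_mul]

lemma integral_normalizedSum (hX : ∀ i, Integrable (X i) P) :
    ∫ ω, normalizedSum P X ω ∂P
      = (∑ i, ∫ ω, X i ω ∂P) / √(∑ i, variance (X i) P) := by
  unfold normalizedSum
  rw [integral_div, integral_finsetSum _ fun i _ => hX i]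

lemma variance_normalizedSum [IsProbabilityMeasure P] (hX : ∀ i, MemLp (X i) 2 P)
    (hind : iIndepFun X P) (hB : 0 < ∑ i, variance (X i) P) :
    variance (normalizedSum P X) P = 1 := by
  have e : normalizedSum P X = fun ω => (√(∑ i, variance (X i) P))⁻¹ * (∑ i, X i) ω := by
    ext ω
    simp only [normalizedSum, Finset.sum_apply]
    ring
  rw [e, variance_const_mul, IndepFun.variance_sum (fun i _ => hX i)
    (fun i _ j _ hij => hind.indepFun hij), inv_pow, Real.sq_sqrt hB.le, inv_mul_cancel₀ hB.ne']

/-- Centring each summand pulls out the phase of the mean, the same phase as in the Gaussian with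
that mean; it disappears from all norms of differences. -/
lemma charFun_normalizedSum [IsProbabilityMeasure P] (hX : ∀ i, Measurable (X i))
    (hXi : ∀ i, Integrable (X i) P) (hind : iIndepFun X P) (t : ℝ) :
    charFun (P.map (normalizedSum P X)) t
      = Complex.exp (t * (∫ ω, normalizedSum P X ω ∂P : ℝ) * Complex.I) *
        ∏ i, charFun (P.map fun ω => (X i ω - ∫ ω', X i ω' ∂P) / √(∑ i, variance (X i) P)) t := by
  set c := √(∑ i, variance (X i) P) with hc
  have hW : ∀ i, Measurable fun ω => (X i ω - ∫ ω', X i ω' ∂P) / c := fun i =>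
    ((hX i).sub_const _).div_const _
  have hindW : iIndepFun (fun i ω => (X i ω - ∫ ω', X i ω' ∂P) / c) P :=
    hind.comp (fun i x => (x - ∫ ω', X i ω' ∂P) / c) fun i => by fun_prop
  have h := congrFun (hindW.charFun_map_fun_sum_eq_prod fun i => (hW i).aemeasurable) t
  rw [Finset.prod_apply] at h
  rw [← h, charFun_map_real (Finset.measurable_sum _ fun i _ => hW i),
    charFun_map_real (measurable_normalizedSum hX), ← integral_const_mul]
  congr 1 with ω
  rw [← Complex.exp_add]
  congr 1
  rw [integral_normalizedSum hXi, normalizedSum, ← hc, ← Finset.sum_div, Finset.sum_sub_distrib]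
  push_cast
  ring

/-- Bernoulli's inequality with exponent `n / 4 ≥ 1`, then fourth powers. -/
lemma one_add_pow_four_le {n : ℕ} (hn : 4 ≤ n) {x : ℝ} (hx : 0 ≤ x) :
    (1 + x) ^ 4 ≤ (1 + 4 * x / n) ^ n := by
  have hn' : (4 : ℝ) ≤ n := by exact_mod_cast hn
  have h := one_add_mul_self_le_rpow_one_add (s := 4 * x / n)
    (by have : 0 ≤ 4 * x / n := by positivity
        linarith) (p := n / 4) (by linarith)
  have e : (n / 4 : ℝ) * (4 * x / n) = x := by field_simp
  rw [e] at h
  refine (pow_le_pow_left₀ (by positivity) h 4).trans (le_of_eq ?_)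
  rw [← Real.rpow_natCast, ← Real.rpow_mul (by positivity), ← Real.rpow_natCast]
  congr 1
  push_cast
  field_simp

/-- Decay of a product of characteristic functions with Fisher-type decay. -/
lemma prod_norm_le_inv_sq {n : ℕ} (hn : 4 ≤ n) {a : Fin n → ℝ} {J τ u : ℝ} (hJ : 0 < J)
    (h : ∀ i, a i ^ 2 * (J + τ ^ 2) ≤ J) (hu : τ ^ 2 = J * (4 * u ^ 2 / n)) :
    ∏ i, a i ≤ ((1 + u ^ 2) ^ 2)⁻¹ := by
  have hw : 0 ≤ 4 * u ^ 2 / n := by positivity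
  have h1 : ∀ i, a i ^ 2 ≤ (1 + 4 * u ^ 2 / n)⁻¹ := fun i => by
    have := h i
    rw [hu] at this
    rw [← one_div, le_div_iff₀ (by linarith)]
    have h2 : J * (a i ^ 2 * (1 + 4 * u ^ 2 / n)) ≤ J * 1 := by linarith
    exact le_of_mul_le_mul_left h2 hJ
  refine le_of_sq_le_sq ?_ (by positivity)
  rw [← Finset.prod_pow]
  calc ∏ i, a i ^ 2 ≤ ∏ _i : Fin n, (1 + 4 * u ^ 2 / n)⁻¹ :=
        Finset.prod_le_prod (fun i _ => sq_nonneg _) fun i _ => h1 i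
    _ = ((1 + 4 * u ^ 2 / n) ^ n)⁻¹ := by simp
    _ ≤ ((1 + u ^ 2) ^ 4)⁻¹ := inv_anti₀ (by positivity) (one_add_pow_four_le hn (sq_nonneg u))
    _ = (((1 + u ^ 2) ^ 2)⁻¹) ^ 2 := by rw [inv_pow, ← pow_mul]

end NormalizedSum

/-! ### Summands with bounded Fisher information and moments. -/

section EntropicBound

lemma charFun_gaussianReal_one (m t : ℝ) :
    charFun (gaussianReal m 1) t
      = Complex.exp (t * (m : ℝ) * Complex.I) * ((Real.exp (-t ^ 2 / 2) : ℝ) : ℂ) := by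
  rw [charFun_gaussianReal]
  rw [Complex.ofReal_exp, ← Complex.exp_add]
  congr 1
  push_cast
  ring

lemma norm_charFun_gaussianReal_one (m t : ℝ) :
    ‖charFun (gaussianReal m 1) t‖ = Real.exp (-t ^ 2 / 2) := by
  have e : (t : ℂ) * (m : ℝ) * Complex.I = ((t * m : ℝ) : ℂ) * Complex.I := by push_cast; ring
  rw [charFun_gaussianReal_one, norm_mul, e, Complex.norm_exp_ofReal_mul_I, one_mul,
    Complex.norm_real, Real.norm_eq_abs, Real.abs_exp]

lemma integrable_charFun_gaussianReal_one (m : ℝ) :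
    Integrable (charFun (gaussianReal m 1)) := by
  refine (integrable_abs_pow_mul_exp (a := 2) (by norm_num) 0).mono'
    (measurable_charFun).aestronglyMeasurable (Filter.Eventually.of_forall fun t => ?_)
  rw [norm_charFun_gaussianReal_one, pow_zero, one_mul]

variable {Ω : Type*} [MeasurableSpace Ω] {P : Measure Ω} [IsProbabilityMeasure P] {n : ℕ}
  {X : Fin n → Ω → ℝ} {p : Fin n → ℝ → ℝ} {J A : ℝ}

/-- The assumptions of the entropic central limit theorem: independent variables with moments
bounded by powers of `A` and Fisher information bounded by `J`. -/
structure BoundedFisherSummands (P : Measure Ω) (X : Fin n → Ω → ℝ) (p : Fin n → ℝ → ℝ)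
    (J A : ℝ) : Prop where
  pos : 1 ≤ n
  fisher_pos : 0 < J
  nonneg : 0 ≤ A
  measurable : ∀ i, Measurable (X i)
  indep : iIndepFun X P
  density : ∀ i, HasAbsolutelyContinuousDensity P (X i) (p i)
  fisher_le : ∀ i, fisherInformation (p i) ≤ ENNReal.ofReal J
  memLp : ∀ i, MemLp (X i) 3 P
  variance_le : ∀ i, variance (X i) P ≤ A ^ 2
  third_le : ∀ i, ∫ ω, |X i ω - ∫ ω', X i ω' ∂P| ^ 3 ∂P ≤ 8 * A ^ 3

namespace BoundedFisherSummands

lemma norm_charFun_sq_mul_le (h : BoundedFisherSummands P X p J A) (i : Fin n) (t : ℝ) :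
    ‖charFun (P.map (X i)) t‖ ^ 2 * (J + t ^ 2) ≤ J := by
  have := Measure.isProbabilityMeasure_map (μ := P) (h.measurable i).aemeasurable
  exact _root_.norm_charFun_sq_mul_le (h.density i).nonneg (h.density i).absolutelyContinuous
    (h.density i).law_eq h.fisher_pos.le (h.fisher_le i) t

lemma memLp_two (h : BoundedFisherSummands P X p J A) (i : Fin n) : MemLp (X i) 2 P :=
  (h.memLp i).mono_exponent (by norm_num)

lemma integrable (h : BoundedFisherSummands P X p J A) (i : Fin n) : Integrable (X i) P :=
  (h.memLp i).integrable (by norm_num)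

lemma one_le_mul_variance (h : BoundedFisherSummands P X p J A) (i : Fin n) :
    1 ≤ J * variance (X i) P := by
  have := Measure.isProbabilityMeasure_map (μ := P) (h.measurable i).aemeasurable
  rw [← variance_id_map (h.measurable i).aemeasurable]
  refine one_le_mul_variance_of_charFun ?_ h.fisher_pos.le (h.norm_charFun_sq_mul_le i)
  rw [memLp_map_measure_iff aestronglyMeasurable_id (h.measurable i).aemeasurable]
  exact h.memLp_two i

/-- Cramér-Rao summed over the summands; this is what makes `b ≥ 1`. -/
lemma card_le (h : BoundedFisherSummands P X p J A) : (n : ℝ) ≤ J * ∑ i, variance (X i) P := by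
  rw [Finset.mul_sum]
  calc (n : ℝ) = ∑ _i : Fin n, (1 : ℝ) := by simp
    _ ≤ _ := Finset.sum_le_sum fun i _ => h.one_le_mul_variance i

omit [IsProbabilityMeasure P] in
lemma card_pos (h : BoundedFisherSummands P X p J A) : (1 : ℝ) ≤ n := by exact_mod_cast h.pos

lemma sum_variance_pos (h : BoundedFisherSummands P X p J A) : 0 < ∑ i, variance (X i) P := by
  have h1 := h.card_le
  have h2 := h.card_pos
  by_contra! hlt
  have := mul_nonpos_of_nonneg_of_nonpos h.fisher_pos.le hlt
  linarith

omit [IsProbabilityMeasure P] in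
lemma sum_variance_le (h : BoundedFisherSummands P X p J A) :
    ∑ i, variance (X i) P ≤ n * A ^ 2 := by
  calc ∑ i, variance (X i) P ≤ ∑ _i : Fin n, A ^ 2 := Finset.sum_le_sum fun i _ => h.variance_le i
    _ = _ := by simp

/-- Each factor is evaluated at `τ = t / √B`; with `u = t / (2 √b)` this is `τ² = J (4 u² / n)`. -/
lemma norm_charFun_normalizedSum_le (h : BoundedFisherSummands P X p J A) (hn : 4 ≤ n) (t : ℝ) :
    ‖charFun (P.map (normalizedSum P X)) t‖
      ≤ ((1 + (t / (2 * √(J * (∑ i, variance (X i) P) / n))) ^ 2) ^ 2)⁻¹ := by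
  have hB := h.sum_variance_pos
  have hJ := h.fisher_pos
  have hn0 : (0 : ℝ) < n := by have := h.card_pos; linarith
  have e : (t : ℂ) * (∫ ω, normalizedSum P X ω ∂P : ℝ) * Complex.I
      = ((t * ∫ ω, normalizedSum P X ω ∂P : ℝ) : ℂ) * Complex.I := by push_cast; ring
  rw [charFun_normalizedSum h.measurable h.integrable h.indep, norm_mul, e,
    Complex.norm_exp_ofReal_mul_I, one_mul, norm_prod]
  simp only [norm_charFun_map_sub_div (h.measurable _)]
  refine prod_norm_le_inv_sq hn hJ
    (fun i => h.norm_charFun_sq_mul_le i _) ?_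
  rw [div_pow, Real.sq_sqrt hB.le, div_pow, mul_pow, Real.sq_sqrt (by positivity)]
  field_simp
  norm_num

lemma norm_charFun_normalizedSum_sub_le (h : BoundedFisherSummands P X p J A)
    {Λ t : ℝ} (hΛ : Λ = 8 * n * A ^ 3 / (√(∑ i, variance (X i) P)) ^ 3) (hΛ1 : Λ ≤ 1 / 64)
    (ht : 16 * Λ * |t| ≤ 1) :
    ‖charFun (P.map (normalizedSum P X)) t
        - charFun (gaussianReal (∫ ω, normalizedSum P X ω ∂P) 1) t‖
      ≤ 5 * Λ * |t| ^ 3 * Real.exp (-t ^ 2 / 8) := by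
  have hB := h.sum_variance_pos
  have hA := h.nonneg
  have e : (t : ℂ) * (∫ ω, normalizedSum P X ω ∂P : ℝ) * Complex.I
      = ((t * ∫ ω, normalizedSum P X ω ∂P : ℝ) : ℂ) * Complex.I := by push_cast; ring
  rw [charFun_normalizedSum h.measurable h.integrable h.indep, charFun_gaussianReal_one, ← mul_sub,
    norm_mul, e, Complex.norm_exp_ofReal_mul_I, one_mul]
  set B := ∑ i, variance (X i) P with hBdef
  set c := √B with hc
  have hc0 : 0 < c := Real.sqrt_pos.2 hB
  have hc2 : c ^ 2 = B := Real.sq_sqrt hB.le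
  have hW : ∀ i, Measurable fun ω => (X i ω - ∫ ω', X i ω' ∂P) / c := fun i =>
    ((h.measurable i).sub_const _).div_const _
  have : ∀ i, IsProbabilityMeasure (P.map fun ω => (X i ω - ∫ ω', X i ω' ∂P) / c) := fun i =>
    Measure.isProbabilityMeasure_map (hW i).aemeasurable
  -- The bound `8 A³ / c³` is used as `β` for every summand, rather than the actual third moments,
  -- so `v³ ≤ β²` follows directly from the bound `A²` on the variances.
  refine norm_prod_charFun_sub_exp_le (v := fun i => variance (X i) P / B)
    (β := fun _ => 8 * A ^ 3 / c ^ 3) (fun i => ?_) (fun i => ?_) (fun i => ?_) (fun i => ?_)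
    (fun i => ?_) (fun i => by positivity) ?_ ?_ hΛ1 ht
  · rw [integral_map (hW i).aemeasurable (Continuous.aestronglyMeasurable (by fun_prop)),
      integral_div, integral_sub (h.integrable i) (integrable_const _)]
    simp
  · rw [integral_map (hW i).aemeasurable (Continuous.aestronglyMeasurable (by fun_prop))]
    simp only [div_pow, hc2]
    rw [integral_div, variance_eq_integral (h.measurable i).aemeasurable]
  · rw [memLp_map_measure_iff aestronglyMeasurable_id (hW i).aemeasurable]
    have := ((h.memLp i).sub (memLp_const (∫ ω', X i ω' ∂P))).mul_const c⁻¹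
    simpa [Function.comp_def, div_eq_mul_inv] using this
  · rw [integral_map (hW i).aemeasurable (Continuous.aestronglyMeasurable (by fun_prop))]
    simp only [abs_div, div_pow, abs_of_pos hc0]
    rw [integral_div]
    exact div_le_div_of_nonneg_right (h.third_le i) (by positivity)
  · have h1 : variance (X i) P ^ 3 ≤ (A ^ 2) ^ 3 :=
      pow_le_pow_left₀ (variance_nonneg _ _) (h.variance_le i) 3
    have e2 : (8 * A ^ 3 / c ^ 3) ^ 2 = 64 * (A ^ 2) ^ 3 / B ^ 3 := by
      rw [← hc2]; ring
    rw [e2, div_pow]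
    refine div_le_div_of_nonneg_right ?_ (by positivity)
    have : 0 ≤ (A ^ 2) ^ 3 := by positivity
    linarith
  · rw [← Finset.sum_div, ← hBdef, div_self hB.ne']
  · rw [hΛ]
    simp only [Finset.sum_const, Finset.card_univ, Fintype.card_fin, nsmul_eq_mul]
    exact le_of_eq (by ring)

end BoundedFisherSummands

end EntropicBound

/-! ### The divergence bound in terms of `b` and `Λ`, and removal of `b`. -/

section EntropicBound

namespace BoundedFisherSummands

variable {Ω : Type*} [MeasurableSpace Ω] {P : Measure Ω} [IsProbabilityMeasure P] {n : ℕ}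
  {X : Fin n → Ω → ℝ} {p : Fin n → ℝ → ℝ} {J A : ℝ}

lemma memLp_normalizedSum (h : BoundedFisherSummands P X p J A) :
    MemLp (normalizedSum P X) 2 P := by
  have := (memLp_finsetSum Finset.univ fun i _ => h.memLp_two i).mul_const
    (√(∑ i, variance (X i) P))⁻¹
  convert this using 2 with ω
  rw [normalizedSum, div_eq_mul_inv]

lemma divergence_eq (h : BoundedFisherSummands P X p J A) :
    divergenceFromGaussian P (normalizedSum P X) = InformationTheory.klDiv
      (P.map (normalizedSum P X)) (gaussianReal (∫ ω, normalizedSum P X ω ∂P) 1) := by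
  rw [divergenceFromGaussian, variance_normalizedSum h.memLp_two h.indep h.sum_variance_pos,
    Real.toNNReal_one]

lemma density_second_moment (h : BoundedFisherSummands P X p J A) {q : ℝ → ℝ}
    (hq : ∀ x, 0 ≤ q x) (hm : Measurable q)
    (hlaw : P.map (normalizedSum P X) = volume.withDensity fun x => ENNReal.ofReal (q x)) :
    Integrable (fun x => (x - ∫ ω, normalizedSum P X ω ∂P) ^ 2 * q x) ∧
      ∫ x, (x - ∫ ω, normalizedSum P X ω ∂P) ^ 2 * q x = 1 := by
  have hS := measurable_normalizedSum (P := P) h.measurable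
  set m := ∫ ω, normalizedSum P X ω ∂P with hmdef
  constructor
  · rw [← integrable_withDensity_ofReal_iff hq hm, ← hlaw, integrable_map_measure
      (Continuous.aestronglyMeasurable (by fun_prop)) hS.aemeasurable]
    exact (h.memLp_normalizedSum.sub (memLp_const m)).integrable_sq
  · have h1 := integral_withDensity_ofReal hq hm (fun x => (x - m) ^ 2)
    rw [← hlaw, integral_map hS.aemeasurable (Continuous.aestronglyMeasurable (by fun_prop)),
      hmdef, ← variance_eq_integral hS.aemeasurable,
      variance_normalizedSum h.memLp_two h.indep h.sum_variance_pos, ← hmdef] at h1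
    rw [h1]
    congr 1 with x
    rw [smul_eq_mul, mul_comm]

lemma one_le_ratio (h : BoundedFisherSummands P X p J A) :
    1 ≤ J * (∑ i, variance (X i) P) / n := by
  rw [one_le_div (by have := h.card_pos; linarith)]
  exact h.card_le

/-- Since `B ≤ n A²`, the ratio cannot be small for few summands; this disposes of `n < 4` and shows
that `Λ` is positive. -/
lemma lyapunov_ge (h : BoundedFisherSummands P X p J A) {Λ : ℝ}
    (hΛ : Λ = 8 * n * A ^ 3 / (√(∑ i, variance (X i) P)) ^ 3) : 8 / √n ≤ Λ := by
  have hn := h.card_pos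
  have hB := h.sum_variance_pos
  have hA := h.nonneg
  have hc : 0 < √(∑ i, variance (X i) P) := Real.sqrt_pos.2 hB
  have hsn : 0 < √(n : ℝ) := Real.sqrt_pos.2 (by linarith)
  have h1 : √(∑ i, variance (X i) P) ≤ √n * A := by
    refine Real.sqrt_le_iff.2 ⟨by positivity, ?_⟩
    rw [mul_pow, Real.sq_sqrt (by linarith)]
    exact h.sum_variance_le
  have h2 := pow_le_pow_left₀ hc.le h1 3
  rw [hΛ, div_le_div_iff₀ hsn (by positivity)]
  have e : (√(n : ℝ) * A) ^ 3 = n * A ^ 3 * √n := by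
    rw [mul_pow, pow_succ, Real.sq_sqrt (by linarith)]; ring
  rw [e] at h2
  linarith

/-- The divergence of a normalized sum in terms of the normalized Fisher information `b` and of
the Lyapunov ratio `Λ`. -/
lemma exists_divergence_le : ∃ C : ℝ, 0 < C ∧
    ∀ (Ω : Type*) [MeasurableSpace Ω] (P : Measure Ω) [IsProbabilityMeasure P]
      (n : ℕ) (X : Fin n → Ω → ℝ) (p : Fin n → ℝ → ℝ) (J A b Λ : ℝ),
      BoundedFisherSummands P X p J A → b = J * (∑ i, variance (X i) P) / n →
      Λ = 8 * n * A ^ 3 / (√(∑ i, variance (X i) P)) ^ 3 →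
      divergenceFromGaussian P (normalizedSum P X) ≤
        ENNReal.ofReal (C * (1 + Real.log b) * √(min 1 (Λ * b))) := by
  obtain ⟨C₁, hC₁, hF⟩ := exists_integral_norm_sub_exp_le
  set C₂ := 4 + 2 * ∫ x, x ^ 6 ∂(gaussianReal 0 1) with hC₂def
  have hC₂ : 0 < C₂ := by
    have : 0 ≤ ∫ x : ℝ, x ^ 6 ∂(gaussianReal 0 1) := integral_nonneg fun x => by positivity
    linarith
  -- The term `5 * C₂ * √C₁` serves the regime of close densities; the rest is `5 * (8 + √C₁)`, from
  -- the crude bound.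
  refine ⟨40 + 5 * √C₁ + 5 * C₂ * √C₁, by positivity, ?_⟩
  intro Ω _ P _ n X p J A b Λ h hb hΛ
  have hb1 : 1 ≤ b := by rw [hb]; exact h.one_le_ratio
  have hlb : 0 ≤ Real.log b := Real.log_nonneg hb1
  have hJ := h.fisher_pos
  have hB := h.sum_variance_pos
  have hn := h.card_pos
  have hA := h.nonneg
  have hn0 : (0 : ℝ) < n := by linarith
  have hΛ0 : 0 < Λ := lt_of_lt_of_le (by positivity) (h.lyapunov_ge hΛ)
  obtain ⟨q, hq0, hqc, hqK, hlaw⟩ := exists_density_normalizedSum h.measurable h.indep h.density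
    hJ h.fisher_le hB ⟨0, h.pos⟩
  have hprob : IsProbabilityMeasure (P.map (normalizedSum P X)) :=
    Measure.isProbabilityMeasure_map (measurable_normalizedSum h.measurable).aemeasurable
  have hprob' : IsProbabilityMeasure (volume.withDensity fun x => ENNReal.ofReal (q x)) :=
    hlaw ▸ hprob
  obtain ⟨hi2, hvar⟩ := h.density_second_moment hq0 hqc.measurable hlaw
  rw [h.divergence_eq]
  have hs0 : 0 ≤ √(min 1 (Λ * b)) := Real.sqrt_nonneg _
  -- Wherever `√(min 1 (Λ b))` is bounded below by a constant, the logarithmic bound on the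
  -- divergence is already of the required form.
  have hcrude : ∀ D : ℝ, D ≤ 5 * (1 + Real.log b) → 1 ≤ (8 + √C₁) * √(min 1 (Λ * b)) →
      D ≤ (40 + 5 * √C₁ + 5 * C₂ * √C₁) * (1 + Real.log b) * √(min 1 (Λ * b)) := by
    intro D hD h1
    have h2 : 5 * (1 + Real.log b) * 1
        ≤ 5 * (1 + Real.log b) * ((8 + √C₁) * √(min 1 (Λ * b))) :=
      mul_le_mul_of_nonneg_left h1 (by positivity)
    have h3 : 0 ≤ 5 * C₂ * √C₁ * ((1 + Real.log b) * √(min 1 (Λ * b))) := by positivity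
    linarith
  rcases lt_or_ge n 4 with hn4 | hn4
  · -- few summands: the bound on the density of one summand suffices
    have hn3 : (n : ℝ) ≤ 3 := by exact_mod_cast Nat.lt_succ_iff.1 hn4
    rw [hlaw]
    refine (klDiv_gaussianReal_le_log hq0 hqc.measurable hqK hi2 hvar).trans
      (ENNReal.ofReal_le_ofReal (hcrude _ ?_ ?_))
    · rw [← Real.sqrt_mul hB.le, Real.log_sqrt (by positivity)]
      have e : (∑ i, variance (X i) P) * J = b * n := by rw [hb]; field_simp
      rw [e, Real.log_mul (by positivity) (by positivity)]
      have := Real.log_le_sub_one_of_pos hn0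
      linarith
    · have h1 : 1 ≤ Λ := by
        refine le_trans ?_ (h.lyapunov_ge hΛ)
        rw [one_le_div (by positivity)]
        refine Real.sqrt_le_iff.2 ⟨by norm_num, by linarith⟩
      rw [min_eq_left (by nlinarith), Real.sqrt_one]
      have := Real.sqrt_nonneg C₁
      linarith
  · have hdec := h.norm_charFun_normalizedSum_le hn4
    rw [← hb] at hdec
    have hmeas : AEStronglyMeasurable (charFun (P.map (normalizedSum P X))) :=
      measurable_charFun.aestronglyMeasurable
    have hfi := integrable_of_norm_le_inv_sq hmeas (by linarith : 0 < b) hdec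
    have hqb : ∀ x, q x ≤ 2 * Real.pi * √b := fun x =>
      (density_le_integral_norm_charFun hq0 hqc hlaw hfi x).trans
        (integral_norm_le_of_norm_le_inv_sq hmeas (by linarith) hdec)
    have hpi := Real.pi_gt_three
    have hpi' := Real.pi_lt_four
    have hsb : 1 ≤ √b := Real.one_le_sqrt.2 hb1
    have hK1 : 1 ≤ 2 * Real.pi * √b := by nlinarith
    have hlogK : Real.log (2 * Real.pi * √b) ≤ 2 + Real.log b := by
      rw [Real.log_mul (by positivity) (by positivity), Real.log_sqrt (by linarith)]
      have : Real.log (2 * Real.pi) ≤ 2 := by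
        rw [Real.log_le_iff_le_exp (by positivity)]
        have h := Real.exp_one_gt_d9
        have : Real.exp 2 = Real.exp 1 * Real.exp 1 := by rw [← Real.exp_add]; norm_num
        have := Real.pi_lt_d2
        nlinarith
      linarith
    have hcr : 3 + Real.log (2 * Real.pi * √b) ≤ 5 * (1 + Real.log b) := by linarith
    have hDlog := klDiv_gaussianReal_le_log hq0 hqc.measurable hqb hi2 hvar
    rw [← hlaw] at hDlog
    by_cases hΛ1 : Λ ≤ 1 / 64
    · have hη : ∀ x, |q x - gaussianPDFReal (∫ ω, normalizedSum P X ω ∂P) 1 x| ≤ C₁ * (Λ * b) :=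
        fun x => (abs_density_sub_le_integral_norm_charFun_sub hq0 hqc hlaw hfi
            (gaussianPDFReal_nonneg _ _) (by unfold gaussianPDFReal; fun_prop)
            (gaussianReal_of_var_ne_zero _ one_ne_zero)
            (integrable_charFun_gaussianReal_one _) x).trans
          (hF _ _ b Λ hmeas measurable_charFun.aestronglyMeasurable hb1 hΛ0.le hdec
            (fun t => (norm_charFun_gaussianReal_one _ t).le)
            fun t ht => h.norm_charFun_normalizedSum_sub_le hΛ hΛ1 ht)
      -- If either condition fails, `Λ b` exceeds `1 / C₁` or 1, and the crude bound applies.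
      by_cases hη1 : C₁ * (Λ * b) ≤ 1 ∧ Λ * b ≤ 1
      · have hD := klDiv_gaussianReal_le_sqrt hq0 hqc.measurable hK1 hqb hi2 hvar
          (by positivity) hη1.1 hη
        rw [hlaw]
        refine hD.trans (ENNReal.ofReal_le_ofReal ?_)
        rw [min_eq_right hη1.2, Real.sqrt_mul hC₁.le, ← hC₂def]
        have h1 : C₂ * (3 + Real.log (2 * Real.pi * √b)) * (√C₁ * √(Λ * b))
            ≤ C₂ * (5 * (1 + Real.log b)) * (√C₁ * √(Λ * b)) := by gcongr
        have h2 : 0 ≤ (40 + 5 * √C₁) * ((1 + Real.log b) * √(Λ * b)) := by positivity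
        linarith
      · refine hDlog.trans (ENNReal.ofReal_le_ofReal (hcrude _ hcr ?_))
        rcases le_total (Λ * b) 1 with h1 | h1
        · rw [min_eq_right h1]
          have h2 : 1 < C₁ * (Λ * b) := by
            by_contra! h3; exact hη1 ⟨h3, h1⟩
          have h3 : 1 ≤ √C₁ * √(Λ * b) := by
            rw [← Real.sqrt_mul hC₁.le]; exact Real.one_le_sqrt.2 h2.le
          have := Real.sqrt_nonneg (Λ * b)
          linarith
        · rw [min_eq_left h1, Real.sqrt_one]
          have := Real.sqrt_nonneg C₁
          linarith
    · refine hDlog.trans (ENNReal.ofReal_le_ofReal (hcrude _ hcr ?_))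
      push Not at hΛ1
      have h1 : 1 / 8 ≤ √(min 1 (Λ * b)) := by
        refine Real.le_sqrt_of_sq_le (le_min (by norm_num) ?_)
        nlinarith
      have := mul_nonneg (Real.sqrt_nonneg C₁) hs0
      linarith

end BoundedFisherSummands

/-- As the minimum is at most 1, its square root is at most its power `θ ≤ 1 / 2`. The resulting `b
^ (-θ / 2)` absorbs `1 + log b`, at the cost of the constant `1 + 2 / θ`. -/
lemma one_add_log_mul_sqrt_min_le {θ b x : ℝ} (hθ0 : 0 < θ) (hθ : θ ≤ 1 / 2) (hb : 1 ≤ b)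
    (hx : 0 < x) :
    (1 + Real.log b) * √(min 1 (x / √b)) ≤ (1 + 2 / θ) * x ^ θ := by
  have hb0 : 0 < b := by linarith
  have hy : 0 < x / √b := by positivity
  have hm : 0 < min 1 (x / √b) := lt_min one_pos hy
  have h1 : √(min 1 (x / √b)) ≤ x ^ θ / b ^ (θ / 2) := by
    rw [Real.sqrt_eq_rpow]
    calc min 1 (x / √b) ^ (1 / 2 : ℝ) ≤ min 1 (x / √b) ^ θ :=
          Real.rpow_le_rpow_of_exponent_ge hm (min_le_left _ _) hθ
      _ ≤ (x / √b) ^ θ := Real.rpow_le_rpow hm.le (min_le_right _ _) hθ0.le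
      _ = x ^ θ / b ^ (θ / 2) := by
          rw [Real.div_rpow hx.le (Real.sqrt_nonneg _), Real.sqrt_eq_rpow, ← Real.rpow_mul hb0.le]
          congr 2
          ring
  have hbθ : 1 ≤ b ^ (θ / 2) := Real.one_le_rpow hb (by positivity)
  have h2 : 1 + Real.log b ≤ (1 + 2 / θ) * b ^ (θ / 2) := by
    have h3 := Real.log_le_rpow_div hb0.le (by positivity : 0 < θ / 2)
    have e : b ^ (θ / 2) / (θ / 2) = 2 / θ * b ^ (θ / 2) := by field_simp
    rw [e] at h3
    linarith
  calc (1 + Real.log b) * √(min 1 (x / √b))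
      ≤ ((1 + 2 / θ) * b ^ (θ / 2)) * (x ^ θ / b ^ (θ / 2)) :=
        mul_le_mul h2 h1 (Real.sqrt_nonneg _) (by positivity)
    _ = _ := by field_simp

/-- In `Λ b` the sum of variances enters as `B ^ (-1 / 2)`, which is exactly its power in `1 / √b`;
all remaining factors depend only on `κ`, `n`, `s` and `A`. -/
lemma lyapunov_mul_ratio_eq {κ s n B A : ℝ} (hκ : 0 < κ) (hn : 0 < n) (hB : 0 < B) :
    8 * n * A ^ 3 / (√B) ^ 3 * (κ * n ^ s * B / n)
      = 8 * κ ^ (3 / 2 : ℝ) * (A ^ 3 / n ^ (1 / 2 - 3 * s / 2)) / √(κ * n ^ s * B / n) := by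
  have hns : 0 < n ^ s := Real.rpow_pos_of_pos hn s
  set b := κ * n ^ s * B / n with hb
  have hb0 : 0 < b := by positivity
  have hsb : 0 < √b := Real.sqrt_pos.2 hb0
  have hsB : 0 < √B := Real.sqrt_pos.2 hB
  rw [eq_div_iff hsb.ne']
  have e1 : b * √b = κ ^ (3 / 2 : ℝ) * n ^ (3 * s / 2) * (√B) ^ 3 / n ^ (3 / 2 : ℝ) := by
    have e2 : b * √b = b ^ (3 / 2 : ℝ) := by
      rw [Real.sqrt_eq_rpow]
      nth_rewrite 1 [← Real.rpow_one b]
      rw [← Real.rpow_add hb0]; norm_num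
    have e3 : (√B) ^ 3 = B ^ (3 / 2 : ℝ) := by
      rw [Real.sqrt_eq_rpow, ← Real.rpow_natCast, ← Real.rpow_mul hB.le]; norm_num
    rw [e2, e3, hb, Real.div_rpow (by positivity) hn.le, Real.mul_rpow (by positivity) hB.le,
      Real.mul_rpow hκ.le hns.le, ← Real.rpow_mul hn.le]
    congr 4
    ring
  have e4 : n ^ (3 / 2 : ℝ) = n * n ^ (1 / 2 - 3 * s / 2) * n ^ (3 * s / 2) := by
    nth_rewrite 2 [← Real.rpow_one n]
    rw [← Real.rpow_add hn, ← Real.rpow_add hn]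
    congr 1
    ring
  rw [mul_assoc, e1, e4]
  have := Real.rpow_pos_of_pos hn (1 / 2 - 3 * s / 2)
  have := Real.rpow_pos_of_pos hn (3 * s / 2)
  field_simp

end EntropicBound

theorem mainTheorem10
    (ε s r κ : ℝ) (hε : 0 < ε) (hε' : ε < 1 / 2) (hs : 0 < s) (hs' : s < 1)
    (hr : 0 < r) (hκ : 0 < κ) :
    ∃ C : ℝ, 0 < C ∧
      ∀ (Ω : Type*) [MeasurableSpace Ω] (P : Measure Ω) [IsProbabilityMeasure P]
        (n : ℕ) (k M : ℝ) (X : Fin n → Ω → ℝ) (p : Fin n → ℝ → ℝ),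
        1 ≤ n → 4 ≤ k →
        (∀ i, Measurable (X i)) →
        iIndepFun X P →
        (∀ i, HasAbsolutelyContinuousDensity P (X i) (p i)) →
        (∀ i, Integrable (fun ω => |X i ω| ^ k) P ∧ ∫ ω, |X i ω| ^ k ∂P ≤ M) →
        (∀ i, fisherInformation (p i) ≤ ENNReal.ofReal (κ * (n : ℝ) ^ s)) →
        M ^ (2 / (k * r)) < (n : ℝ) →
        divergenceFromGaussian P (normalizedSum P X) ≤
          ENNReal.ofReal
            (C * (M ^ (4 / k) / (n : ℝ) ^ (1 - 2 * s) + 3) ^ ((1 : ℝ) / 2) *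
              (M ^ (3 / k) / (n : ℝ) ^ (1 / 2 - 3 * s / 2)) ^ (1 / 2 - ε)) := by
  obtain ⟨C₀, hC₀, hmain⟩ := BoundedFisherSummands.exists_divergence_le
  set θ := 1 / 2 - ε with hθ
  have hθ0 : 0 < θ := by linarith
  refine ⟨C₀ * (1 + 2 / θ) * (8 * κ ^ (3 / 2 : ℝ)) ^ θ, by positivity, ?_⟩
  intro Ω _ P _ n k M X p hn hk hX hind hp hM hJ _
  have hk0 : 0 < k := by linarith
  have hnR : (1 : ℝ) ≤ n := by exact_mod_cast hn
  have hn0 : (0 : ℝ) < n := by linarith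
  have hM0 : 0 ≤ M := le_trans (integral_nonneg fun ω => by positivity) (hM ⟨0, hn⟩).2
  set A := M ^ (1 / k) with hA
  have hA0 : 0 ≤ A := Real.rpow_nonneg hM0 _
  have hmom : ∀ i, ∀ q : ℕ, 1 ≤ q → q ≤ 4 → ∫ ω, |X i ω| ^ q ∂P ≤ A ^ q := fun i q h1 h4 =>
    integral_abs_pow_le (hX i) (hM i).1 (hM i).2 h1
      (le_trans (by exact_mod_cast h4 : (q : ℝ) ≤ 4) hk)
  have hL : ∀ i, MemLp (X i) 3 P := fun i =>
    memLp_of_integrable_abs_rpow (hX i) (by linarith) (hM i).1 (q := 3) (by push_cast; linarith)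
  have h : BoundedFisherSummands P X p (κ * (n : ℝ) ^ s) A :=
    { pos := hn
      fisher_pos := by positivity
      nonneg := hA0
      measurable := hX
      indep := hind
      density := hp
      fisher_le := hJ
      memLp := hL
      variance_le := fun i =>
        variance_le_of_integral_abs_pow (hX i) (hmom i 2 (by norm_num) (by norm_num))
      third_le := fun i => integral_abs_sub_mean_pow_three_le (hL i)
        (hmom i 1 (by norm_num) (by norm_num)) (hmom i 3 (by norm_num) (by norm_num)) }
  have hB := h.sum_variance_pos
  have hΛ := lt_of_lt_of_le (by positivity : 0 < 8 / √(n : ℝ)) (h.lyapunov_ge rfl)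
  have hb := h.one_le_ratio
  refine (hmain Ω P n X p _ A _ _ h rfl rfl).trans (ENNReal.ofReal_le_ofReal ?_)
  have hM3 : M ^ (3 / k) = A ^ 3 := by
    rw [hA, ← Real.rpow_natCast, ← Real.rpow_mul hM0]
    congr 1
    push_cast
    ring
  have hA3 : 0 ≤ A ^ 3 / (n : ℝ) ^ (1 / 2 - 3 * s / 2) := by positivity
  rw [hM3]
  have e := lyapunov_mul_ratio_eq (s := s) (A := A) hκ hn0 hB
  -- Positivity, hence `A ≠ 0`, is read off from `Λ b > 0`.
  have hx : 0 < 8 * κ ^ (3 / 2 : ℝ) * (A ^ 3 / (n : ℝ) ^ (1 / 2 - 3 * s / 2)) := by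
    have h1 := mul_pos hΛ (by linarith : 0 < κ * (n : ℝ) ^ s * (∑ i, variance (X i) P) / n)
    rw [e] at h1
    by_contra! hneg
    exact absurd h1 (not_lt.2 (div_nonpos_of_nonpos_of_nonneg hneg (Real.sqrt_nonneg _)))
  rw [e]
  have h1 := one_add_log_mul_sqrt_min_le hθ0 (by linarith) hb hx
  -- The summand 3 makes this factor at least 1, so inserting it only enlarges the bound.
  have h2 : 1 ≤ (M ^ (4 / k) / (n : ℝ) ^ (1 - 2 * s) + 3) ^ ((1 : ℝ) / 2) := by
    refine Real.one_le_rpow ?_ (by norm_num)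
    have : 0 ≤ M ^ (4 / k) / (n : ℝ) ^ (1 - 2 * s) := by positivity
    linarith
  rw [Real.mul_rpow (by positivity) hA3] at h1
  have h3 := mul_le_mul_of_nonneg_left h1 hC₀.le
  have h4 : 0 ≤ C₀ * (1 + 2 / θ) * (8 * κ ^ (3 / 2 : ℝ)) ^ θ *
      (A ^ 3 / (n : ℝ) ^ (1 / 2 - 3 * s / 2)) ^ θ := by positivity
  have h5 := mul_le_mul_of_nonneg_left h2 h4
  linarith
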